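/- Let $\mathbf k$ be a field and let $\Omega$ be a finite set of cardinality $w$, with a diassociative semigroup structure and a duplicial semigroup structure (for instance the same pair of products $(\leftarrow,\to)$, as every diassociative semigroup is duplicial). Here a duplicial semigroup is a set with two binary products satisfying $(\alpha\leftarrow\beta)\leftarrow\gamma=\alpha\leftarrow(\beta\leftarrow\gamma)$, $(\alpha\to\beta)\leftarrow\gamma=\alpha\to(\beta\leftarrow\gamma)$, $(\alpha\to\beta)\to\gamma=\alpha\to(\beta\to\gamma)$; it is diassociative if moreover $\alpha\leftarrow(\beta\leftarrow\gamma)=\alpha\leftarrow(\beta\to\gamma)$ and $(\alpha\leftarrow\beta)\to\gamma=(\alpha\to\beta)\to\gamma$. Let $\mathbf{Dend}^2_\Omega$ be the non-symmetric $\mathbf k$-linear operad of two-parameter $\Omega$-dendriform algebras, for the diassociative structure: it is generated by binary operations $\prec_{\alpha,\beta},\succ_{\alpha,\beta}$ $(\alpha,\beta\in\Omega)$ subject to, for all $\alpha,\beta,\gamma\in\Omega$, $$(x\prec_{\alpha,\beta}y)\prec_{\alpha\leftarrow\beta,\gamma}z=x\prec_{\alpha,\beta\leftarrow\gamma}(y\prec_{\beta,\gamma}z)+x\prec_{\alpha,\beta\to\gamma}(y\succ_{\beta,\gamma}z),$$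 $$(x\succ_{\alpha,\beta}y)\prec_{\alpha\to\beta,\gamma}z=x\succ_{\alpha,\beta\leftarrow\gamma}(y\prec_{\beta,\gamma}z),$$ $$x\succ_{\alpha,\beta\to\gamma}(y\succ_{\beta,\gamma}z)=(x\succ_{\alpha,\beta}y)\succ_{\alpha\to\beta,\gamma}z+(x\prec_{\alpha,\beta}y)\succ_{\alpha\leftarrow\beta,\gamma}z.$$ Let $\mathbf{Dup}^2_\Omega$ be the non-symmetric operad of two-parameter $\Omega$-duplicial algebras, for the duplicial structure: it has the same generators and the three relations obtained by deleting the last summand of the first and of the third relation. Then for every $n\ge 1$ the spaces $\mathbf{Dend}^2_\Omega(n)$ and $\mathbf{Dup}^2_\Omega(n)$ are finite-dimensional over $\mathbf k$ and have the same dimension, denoted $r_n$, and the formal series $R=\sum_{n\ge1}r_nX^n\in\mathbb Q[[X]]$ satisfies $$w^2(w-1)R^3+w(wX+2w-2)R^2+(2wX-1)R+X=0.$$ -/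

import Mathlib

noncomputable section

/-- A diassociative semigroup structure on `Ω`; `la` is `←` and `ra` is `→`. -/
structure DiassociativeSemigroup (Ω : Type*) where
  la : Ω → Ω → Ω
  ra : Ω → Ω → Ω
  la_la : ∀ α β γ, la (la α β) γ = la α (la β γ)
  la_la_eq_la_ra : ∀ α β γ, la α (la β γ) = la α (ra β γ)
  ra_la : ∀ α β γ, la (ra α β) γ = ra α (la β γ)
  ra_ra_eq_la_ra : ∀ α β γ, ra (ra α β) γ = ra (la α β) γ
  la_ra : ∀ α β γ, ra (la α β) γ = ra α (ra β γ)

/-- A duplicial semigroup structure on `Ω`; `la` is `←` and `ra` is `→`. -/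
structure DuplicialSemigroup (Ω : Type*) where
  la : Ω → Ω → Ω
  ra : Ω → Ω → Ω
  la_la : ∀ α β γ, la (la α β) γ = la α (la β γ)
  ra_la : ∀ α β γ, la (ra α β) γ = ra α (la β γ)
  ra_ra : ∀ α β γ, ra (ra α β) γ = ra α (ra β γ)

universe u v w

/-- A non-symmetric (non-sigma) operad in `k`-vector spaces, given by its partial compositions.
The inputs of an operation of arity `m` are numbered `0, …, m - 1`, and `comp i x y` plugs the
output of `y` into input `i` of `x`. The arity of the result is the `p` with `m + n = p + 1`. -/
structure NSOperad (k : Type u) [Field k] where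
  obj : ℕ → Type v
  [addCommGroup : ∀ n, AddCommGroup (obj n)]
  [module : ∀ n, Module k (obj n)]
  one : obj 1
  comp : ∀ {m n p : ℕ} (i : ℕ), i < m → m + n = p + 1 → obj m →ₗ[k] obj n →ₗ[k] obj p
  one_comp : ∀ {n : ℕ} (h : 1 + n = n + 1) (x : obj n), comp 0 Nat.one_pos h one x = x
  comp_one : ∀ {m : ℕ} (i : ℕ) (hi : i < m) (x : obj m), comp i hi rfl x one = x
  comp_seq : ∀ {l m n p q r : ℕ} (i j : ℕ) (hi : i < l) (hj : j < m) (hij : i + j < p)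
    (h₁ : l + m = p + 1) (h₂ : p + n = r + 1) (h₃ : m + n = q + 1) (h₄ : l + q = r + 1)
    (x : obj l) (y : obj m) (z : obj n),
    comp (i + j) hij h₂ (comp i hi h₁ x y) z = comp i hi h₄ x (comp j hj h₃ y z)
  comp_par : ∀ {l m n p q r : ℕ} (i j j' : ℕ) (_ : i < j) (hj : j < l) (hi : i < l)
    (_ : j + n = j' + 1) (hip : i < p) (hjq : j' < q)
    (h₁ : l + m = p + 1) (h₂ : p + n = r + 1) (h₃ : l + n = q + 1) (h₄ : q + m = r + 1)
    (x : obj l) (y : obj m) (z : obj n),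
    comp i hip h₂ (comp j hj h₁ x y) z = comp j' hjq h₄ (comp i hi h₃ x z) y

attribute [instance] NSOperad.addCommGroup NSOperad.module

namespace NSOperad

variable {k : Type u} [Field k]

/-- A two-sided operadic ideal. -/
structure Ideal (P : NSOperad.{u, v} k) where
  carrier : ∀ n, Submodule k (P.obj n)
  comp_mem_left : ∀ {m n p : ℕ} (i : ℕ) (hi : i < m) (h : m + n = p + 1)
    (x : P.obj m) (y : P.obj n), x ∈ carrier m → P.comp i hi h x y ∈ carrier p
  comp_mem_right : ∀ {m n p : ℕ} (i : ℕ) (hi : i < m) (h : m + n = p + 1)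
    (x : P.obj m) (y : P.obj n), y ∈ carrier n → P.comp i hi h x y ∈ carrier p

/-- The smallest operadic ideal containing a set `S` of operations of arity `d`. -/
def Ideal.span (P : NSOperad.{u, v} k) {d : ℕ} (S : Set (P.obj d)) : P.Ideal where
  carrier n := ⨅ (J : P.Ideal) (_ : S ⊆ J.carrier d), J.carrier n
  comp_mem_left i hi h x y hx := by
    simp only [Submodule.mem_iInf] at hx ⊢
    exact fun J hJ => J.comp_mem_left i hi h x y (hx J hJ)
  comp_mem_right i hi h x y hy := by
    simp only [Submodule.mem_iInf] at hy ⊢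
    exact fun J hJ => J.comp_mem_right i hi h x y (hy J hJ)

/-- Partial composition on a quotient by an ideal, characterised by `quotientComp_mk`. -/
def quotientComp (P : NSOperad.{u, v} k) (I : P.Ideal) {m n p : ℕ} (i : ℕ) (hi : i < m)
    (h : m + n = p + 1) :
    (P.obj m ⧸ I.carrier m) →ₗ[k] (P.obj n ⧸ I.carrier n) →ₗ[k] (P.obj p ⧸ I.carrier p) :=
  (I.carrier m).liftQ
    (LinearMap.flip ((I.carrier n).liftQ
      (LinearMap.flip ((P.comp i hi h).compr₂ (I.carrier p).mkQ))
      (fun y hy => by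
        ext x
        simpa using I.comp_mem_right i hi h x y hy)))
    (fun x hx => by
      ext y
      exact (Submodule.Quotient.mk_eq_zero _).2 (I.comp_mem_left i hi h x y hx))

theorem quotientComp_mk (P : NSOperad.{u, v} k) (I : P.Ideal) {m n p : ℕ} (i : ℕ) (hi : i < m)
    (h : m + n = p + 1) (x : P.obj m) (y : P.obj n) :
    P.quotientComp I i hi h (Submodule.Quotient.mk x) (Submodule.Quotient.mk y) =
      Submodule.Quotient.mk (P.comp i hi h x y) := rfl

/-- The quotient of an operad by an operadic ideal. -/
def quotient (P : NSOperad.{u, v} k) (I : P.Ideal) : NSOperad.{u, v} k where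
  obj n := P.obj n ⧸ I.carrier n
  one := Submodule.Quotient.mk P.one
  comp := P.quotientComp I
  one_comp h x := by
    induction x using Submodule.Quotient.induction_on with
    | H x => rw [quotientComp_mk, P.one_comp]
  comp_one i hi x := by
    induction x using Submodule.Quotient.induction_on with
    | H x => rw [quotientComp_mk, P.comp_one]
  comp_seq i j hi hj hij h₁ h₂ h₃ h₄ x y z := by
    induction x using Submodule.Quotient.induction_on with
    | H x =>
    induction y using Submodule.Quotient.induction_on with
    | H y =>
    induction z using Submodule.Quotient.induction_on with
    | H z => simp only [quotientComp_mk, P.comp_seq i j hi hj hij h₁ h₂ h₃ h₄]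
  comp_par i j j' hlt hj hi hj' hip hjq h₁ h₂ h₃ h₄ x y z := by
    induction x using Submodule.Quotient.induction_on with
    | H x =>
    induction y using Submodule.Quotient.induction_on with
    | H y =>
    induction z using Submodule.Quotient.induction_on with
    | H z => simp only [quotientComp_mk, P.comp_par i j j' hlt hj hi hj' hip hjq h₁ h₂ h₃ h₄]

/-- The generating series `∑_{n ≥ 1} dim P(n) X ^ n`. -/
def genSeries (P : NSOperad.{u, v} k) : PowerSeries ℚ :=
  PowerSeries.mk fun n => if n = 0 then 0 else (Module.finrank k (P.obj n) : ℚ)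

end NSOperad

/-- Planar binary trees whose internal vertices are decorated by `E`. -/
inductive PBTree (E : Type w) : Type w
  | leaf : PBTree E
  | node (e : E) (l r : PBTree E) : PBTree E

namespace PBTree

variable {E : Type w}

/-- The number of leaves. -/
def leaves : PBTree E → ℕ
  | leaf => 1
  | node _ l r => l.leaves + r.leaves

/-- `s.graft i t` plugs the root of `t` onto the leaf number `i` of `s`; leaves are numbered from
left to right, starting from `0`. -/
def graft : PBTree E → ℕ → PBTree E → PBTree E
  | leaf, _, t => t
  | node e l r, i, t =>
    if i < l.leaves then node e (l.graft i t) r else node e l (r.graft (i - l.leaves) t)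

theorem leaves_graft (s t : PBTree E) (i : ℕ) (hi : i < s.leaves) :
    s.leaves + t.leaves = (s.graft i t).leaves + 1 := by
  induction s generalizing i with
  | leaf => simp [graft, leaves]; omega
  | node e l r ihl ihr =>
    simp only [graft, leaves] at hi ⊢
    split_ifs with h
    · have := ihl i h
      simp only [leaves]; omega
    · have := ihr (i - l.leaves) (by omega)
      simp only [leaves]; omega

theorem graft_leaf (s : PBTree E) (i : ℕ) : s.graft i leaf = s := by
  induction s generalizing i with
  | leaf => rfl
  | node e l r ihl ihr => simp [graft, ihl, ihr]

theorem graft_seq (s t u : PBTree E) (i j : ℕ) (hi : i < s.leaves) (hj : j < t.leaves) :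
    (s.graft i t).graft (i + j) u = s.graft i (t.graft j u) := by
  induction s generalizing i with
  | leaf =>
    simp only [leaves, Nat.lt_one_iff] at hi
    simp [graft, hi]
  | node e l r ihl ihr =>
    simp only [graft, leaves] at hi ⊢
    split_ifs with h
    · have := leaves_graft l t i h
      simp only [graft]
      rw [if_pos (by omega), ihl i h]
    · simp only [graft]
      rw [if_neg (by omega), show i + j - l.leaves = (i - l.leaves) + j by omega,
        ihr _ (by omega)]

theorem graft_par (s t u : PBTree E) (i j j' : ℕ) (hij : i < j) (hj : j < s.leaves)
    (hj' : j + u.leaves = j' + 1) :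
    (s.graft j t).graft i u = (s.graft i u).graft j' t := by
  induction s generalizing i j j' with
  | leaf => simp only [leaves] at hj; omega
  | node e l r ihl ihr =>
    simp only [leaves] at hj
    by_cases h : j < l.leaves
    · have h1 := leaves_graft l t j h
      have h2 := leaves_graft l u i (by omega)
      simp only [graft]
      rw [if_pos h, if_pos (show i < l.leaves by omega)]
      simp only [graft]
      rw [if_pos (by omega), if_pos (by omega), ihl i j j' hij h hj']
    · by_cases h' : i < l.leaves
      · have h2 := leaves_graft l u i h'
        simp only [graft]
        rw [if_neg h, if_pos h']
        simp only [graft]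
        rw [if_pos h', if_neg (by omega)]
        congr 2
        omega
      · simp only [graft]
        rw [if_neg h, if_neg h']
        simp only [graft]
        rw [if_neg h', if_neg (by omega),
          ihr (i - l.leaves) (j - l.leaves) (j' - l.leaves) (by omega) (by omega) (by omega)]

end PBTree

section FreeOperad

variable (k : Type u) [Field k] (E : Type w)

/-- The component of arity `n` of the free operad on binary generators `E`: the vector space with
basis the `E`-decorated planar binary trees with `n` leaves. -/
abbrev FreeObj (n : ℕ) : Type max u w := {t : PBTree E // t.leaves = n} →₀ k

/-- Grafting at the leaf number `i`, extended bilinearly. -/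
def freeComp {m n p : ℕ} (i : ℕ) (hi : i < m) (h : m + n = p + 1) :
    FreeObj k E m →ₗ[k] FreeObj k E n →ₗ[k] FreeObj k E p :=
  Finsupp.linearCombination k fun s : {t : PBTree E // t.leaves = m} =>
    Finsupp.lmapDomain k k fun t : {t : PBTree E // t.leaves = n} =>
      ⟨s.1.graft i t.1, by
        have h₁ := PBTree.leaves_graft s.1 t.1 i (s.2.symm ▸ hi)
        have h₂ := s.2
        have h₃ := t.2
        omega⟩

theorem freeComp_single {m n p : ℕ} (i : ℕ) (hi : i < m) (h : m + n = p + 1)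
    (s : {t : PBTree E // t.leaves = m}) (t : {t : PBTree E // t.leaves = n}) (a b : k)
    (h' : (s.1.graft i t.1).leaves = p) :
    freeComp k E i hi h (Finsupp.single s a) (Finsupp.single t b) =
      Finsupp.single ⟨s.1.graft i t.1, h'⟩ (a * b) := by
  simp [freeComp]

/-- The free non-symmetric operad on a set `E` of binary generators. -/
def freeOperad : NSOperad.{u, max u w} k where
  obj := FreeObj k E
  one := Finsupp.single ⟨PBTree.leaf, rfl⟩ 1
  comp := freeComp k E
  one_comp h x := by
    induction x using Finsupp.induction_linear with
    | zero => simp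
    | add x y hx hy => rw [map_add, hx, hy]
    | single t a =>
      have ht : ((PBTree.leaf : PBTree E).graft 0 t.1).leaves = _ := t.2
      rw [freeComp_single k E 0 _ h ⟨PBTree.leaf, rfl⟩ t 1 a ht]
      simp [PBTree.graft]
  comp_one i hi x := by
    induction x using Finsupp.induction_linear with
    | zero => simp
    | add x y hx hy => rw [map_add, LinearMap.add_apply, hx, hy]
    | single t a =>
      rw [freeComp_single k E i hi rfl _ _ _ _ (by rw [PBTree.graft_leaf]; exact t.2)]
      simp [PBTree.graft_leaf]
  comp_seq {l m n p q r} i j hi hj hij h₁ h₂ h₃ h₄ x y z := by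
    induction x using Finsupp.induction_linear with
    | zero => simp
    | add x x' hx hx' => simp only [map_add, LinearMap.add_apply, hx, hx']
    | single s a =>
    induction y using Finsupp.induction_linear with
    | zero => simp
    | add y y' hy hy' => simp only [map_add, LinearMap.add_apply, hy, hy']
    | single t b =>
    induction z using Finsupp.induction_linear with
    | zero => simp
    | add z z' hz hz' => simp only [map_add, hz, hz']
    | single v c =>
      have hs := s.2
      have ht := t.2
      have hv := v.2
      have e₁ := PBTree.leaves_graft s.1 t.1 i (by omega)
      have e₂ := PBTree.leaves_graft t.1 v.1 j (by omega)
      have e₃ := PBTree.leaves_graft (s.1.graft i t.1) v.1 (i + j) (by omega)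
      have e := PBTree.graft_seq s.1 t.1 v.1 i j (by omega) (by omega)
      have e₄ : (s.1.graft i (t.1.graft j v.1)).leaves = r := by rw [← e]; omega
      rw [freeComp_single k E i hi h₁ s t a b (by omega),
        freeComp_single k E (i + j) hij h₂ _ v _ _ (by simp only; omega),
        freeComp_single k E j hj h₃ t v _ _ (by omega),
        freeComp_single k E i hi h₄ s _ _ _ e₄]
      simp only [e, mul_assoc]
  comp_par {l m n p q r} i j j' hlt hj hi hj' hip hjq h₁ h₂ h₃ h₄ x y z := by
    induction x using Finsupp.induction_linear with
    | zero => simp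
    | add x x' hx hx' => simp only [map_add, LinearMap.add_apply, hx, hx']
    | single s a =>
    induction y using Finsupp.induction_linear with
    | zero => simp
    | add y y' hy hy' => simp only [map_add, LinearMap.add_apply, hy, hy']
    | single t b =>
    induction z using Finsupp.induction_linear with
    | zero => simp
    | add z z' hz hz' => simp only [map_add, LinearMap.add_apply, hz, hz']
    | single v c =>
      have hs := s.2
      have ht := t.2
      have hv := v.2
      have e₁ := PBTree.leaves_graft s.1 t.1 j (by omega)
      have e₂ := PBTree.leaves_graft s.1 v.1 i (by omega)
      have e₃ := PBTree.leaves_graft (s.1.graft j t.1) v.1 i (by omega)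
      have e := PBTree.graft_par s.1 t.1 v.1 i j j' hlt (by omega) (by omega)
      have e₄ : ((s.1.graft i v.1).graft j' t.1).leaves = r := by rw [← e]; omega
      rw [freeComp_single k E j hj h₁ s t a b (by omega),
        freeComp_single k E i hip h₂ _ v _ _ (by simp only; omega),
        freeComp_single k E i hi h₃ s v _ _ (by omega),
        freeComp_single k E j' hjq h₄ _ t _ _ e₄]
      simp only [e, mul_right_comm]

variable {E}

/-- A generator, as an operation `x e y` of arity `2` in the free operad. -/
def freeGen (e : E) : (freeOperad k E).obj 2 :=
  Finsupp.single (⟨PBTree.node e PBTree.leaf PBTree.leaf, rfl⟩ : {t : PBTree E // t.leaves = 2}) 1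

/-- The operation `(x e y) f z`. -/
def leftComb (e f : E) : (freeOperad k E).obj 3 :=
  (freeOperad k E).comp (m := 2) (n := 2) 0 (by omega) rfl (freeGen k f) (freeGen k e)

/-- The operation `x e (y f z)`. -/
def rightComb (e f : E) : (freeOperad k E).obj 3 :=
  (freeOperad k E).comp (m := 2) (n := 2) 1 (by omega) rfl (freeGen k e) (freeGen k f)

end FreeOperad

/-- The generating operations `≺_{α,β}` and `≻_{α,β}`. -/
inductive FamilyGen (Ω : Type w) : Type w
  | prec (α β : Ω) : FamilyGen Ω
  | succ (α β : Ω) : FamilyGen Ω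

open FamilyGen in
/-- The relations of two-parameter `Ω`-dendriform algebras:
`(x ≺_{α,β} y) ≺_{α←β,γ} z = x ≺_{α,β←γ} (y ≺_{β,γ} z) + x ≺_{α,β→γ} (y ≻_{β,γ} z)`,
`(x ≻_{α,β} y) ≺_{α→β,γ} z = x ≻_{α,β←γ} (y ≺_{β,γ} z)`,
`x ≻_{α,β→γ} (y ≻_{β,γ} z) = (x ≻_{α,β} y) ≻_{α→β,γ} z + (x ≺_{α,β} y) ≻_{α←β,γ} z`. -/
def dendRelations (k : Type u) [Field k] {Ω : Type w} (D : DiassociativeSemigroup Ω) :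
    Set ((freeOperad k (FamilyGen Ω)).obj 3) :=
  {f | ∃ α β γ : Ω,
    f = leftComb k (prec α β) (prec (D.la α β) γ)
        - (rightComb k (prec α (D.la β γ)) (prec β γ)
          + rightComb k (prec α (D.ra β γ)) (succ β γ)) ∨
    f = leftComb k (succ α β) (prec (D.ra α β) γ)
        - rightComb k (succ α (D.la β γ)) (prec β γ) ∨
    f = rightComb k (succ α (D.ra β γ)) (succ β γ)
        - (leftComb k (succ α β) (succ (D.ra α β) γ)
          + leftComb k (prec α β) (succ (D.la α β) γ))}

open FamilyGen in
/-- The relations of two-parameter `Ω`-duplicial algebras: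
`(x ≺_{α,β} y) ≺_{α←β,γ} z = x ≺_{α,β←γ} (y ≺_{β,γ} z)`,
`(x ≻_{α,β} y) ≺_{α→β,γ} z = x ≻_{α,β←γ} (y ≺_{β,γ} z)`,
`x ≻_{α,β→γ} (y ≻_{β,γ} z) = (x ≻_{α,β} y) ≻_{α→β,γ} z`. -/
def dupRelations (k : Type u) [Field k] {Ω : Type w} (D : DuplicialSemigroup Ω) :
    Set ((freeOperad k (FamilyGen Ω)).obj 3) :=
  {f | ∃ α β γ : Ω,
    f = leftComb k (prec α β) (prec (D.la α β) γ)
        - rightComb k (prec α (D.la β γ)) (prec β γ) ∨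
    f = leftComb k (succ α β) (prec (D.ra α β) γ)
        - rightComb k (succ α (D.la β γ)) (prec β γ) ∨
    f = rightComb k (succ α (D.ra β γ)) (succ β γ)
        - leftComb k (succ α β) (succ (D.ra α β) γ)}

/-- The non-sigma operad of two-parameter `Ω`-dendriform algebras. -/
def dendOperad (k : Type u) [Field k] {Ω : Type w} (D : DiassociativeSemigroup Ω) :
    NSOperad.{u, max u w} k :=
  (freeOperad k (FamilyGen Ω)).quotient (NSOperad.Ideal.span _ (dendRelations k D))

/-- The non-sigma operad of two-parameter `Ω`-duplicial algebras. -/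
def dupOperad (k : Type u) [Field k] {Ω : Type w} (D : DuplicialSemigroup Ω) :
    NSOperad.{u, max u w} k :=
  (freeOperad k (FamilyGen Ω)).quotient (NSOperad.Ideal.span _ (dupRelations k D))

end

open PBTree FamilyGen

namespace PBTree

/-- The `k`-vector space with basis the `E`-decorated planar binary trees. -/
abbrev Span (k E : Type*) [Field k] := PBTree E →₀ k

/-- The bilinear extension of `PBTree.node e`. -/
noncomputable def nodeB (k : Type*) [Field k] {E : Type*} (e : E) :
    Span k E →ₗ[k] Span k E →ₗ[k] Span k E :=
  Finsupp.linearCombination k fun s => Finsupp.lmapDomain k k (node e s)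

theorem nodeB_single {k : Type*} [Field k] {E : Type*} (e : E) (s t : PBTree E) (a b : k) :
    nodeB k e (.single s a) (.single t b) = .single (node e s t) (a * b) := by
  simp [nodeB]

end PBTree

/-- The common form of the duplicial (`q = 0`) and dendriform (`q = 1`) relations. -/
def twistedRelations (k : Type*) [Field k] {Ω : Type*} (la ra : Ω → Ω → Ω) (q : k) :
    Set ((freeOperad k (FamilyGen Ω)).obj 3) :=
  {f | ∃ α β γ : Ω,
    f = leftComb k (prec α β) (prec (la α β) γ)
        - (rightComb k (prec α (la β γ)) (prec β γ)
          + q • rightComb k (prec α (ra β γ)) (succ β γ)) ∨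
    f = leftComb k (succ α β) (prec (ra α β) γ)
        - rightComb k (succ α (la β γ)) (prec β γ) ∨
    f = rightComb k (succ α (ra β γ)) (succ β γ)
        - (leftComb k (succ α β) (succ (ra α β) γ)
          + q • leftComb k (prec α β) (succ (la α β) γ))}

theorem dendRelations_eq (k : Type*) [Field k] {Ω : Type*} (D : DiassociativeSemigroup Ω) :
    dendRelations k D = twistedRelations k D.la D.ra 1 := by
  simp only [dendRelations, twistedRelations, one_smul]

theorem dupRelations_eq (k : Type*) [Field k] {Ω : Type*} (D : DuplicialSemigroup Ω) :
    dupRelations k D = twistedRelations k D.la D.ra 0 := by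
  simp only [dupRelations, twistedRelations, zero_smul, add_zero]

/-- The products `la`, `ra` are duplicial, and diassociative if `q = 1`. -/
structure TwistedSemigroup {k : Type*} [Field k] {Ω : Type*} (la ra : Ω → Ω → Ω) (q : k) :
    Prop where
  la_la : ∀ α β γ, la (la α β) γ = la α (la β γ)
  ra_la : ∀ α β γ, la (ra α β) γ = ra α (la β γ)
  ra_ra : ∀ α β γ, ra (ra α β) γ = ra α (ra β γ)
  twist : q = 0 ∨ q = 1 ∧ (∀ α β γ, la α (ra β γ) = la α (la β γ)) ∧
    ∀ α β γ, ra (la α β) γ = ra α (ra β γ)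

theorem DiassociativeSemigroup.twisted (k : Type*) [Field k] {Ω : Type*}
    (D : DiassociativeSemigroup Ω) : TwistedSemigroup D.la D.ra (1 : k) where
  la_la := D.la_la
  ra_la := D.ra_la
  ra_ra α β γ := by rw [D.ra_ra_eq_la_ra, D.la_ra]
  twist := .inr ⟨rfl, fun α β γ => (D.la_la_eq_la_ra α β γ).symm, D.la_ra⟩

theorem DuplicialSemigroup.twisted (k : Type*) [Field k] {Ω : Type*}
    (D : DuplicialSemigroup Ω) : TwistedSemigroup D.la D.ra (0 : k) where
  la_la := D.la_la
  ra_la := D.ra_la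
  ra_ra := D.ra_ra
  twist := .inl rfl

section Product

variable {k : Type*} [Field k] {Ω : Type*} (la ra : Ω → Ω → Ω) (q : k)

open Classical in
/-- The product `x e y` of two trees in the free algebra on one generator: the tree `node e x y`,
rewritten if the root of `x` and `e` form the leading left comb of a relation. -/
noncomputable def treeOp :
    PBTree (FamilyGen Ω) → FamilyGen Ω → PBTree (FamilyGen Ω) → Span k (FamilyGen Ω)
  | node (prec α β) a b, prec δ γ, t =>
    if δ = la α β then
      nodeB k (prec α (la β γ)) (.single a 1) (treeOp b (prec β γ) t)
        + q • nodeB k (prec α (ra β γ)) (.single a 1) (treeOp b (succ β γ) t)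
    else .single (node (prec δ γ) (node (prec α β) a b) t) 1
  | node (succ α β) a b, prec δ γ, t =>
    if δ = ra α β then nodeB k (succ α (la β γ)) (.single a 1) (treeOp b (prec β γ) t)
    else .single (node (prec δ γ) (node (succ α β) a b) t) 1
  | node (succ α β) a b, succ δ γ, t =>
    if δ = ra α β then
      nodeB k (succ α (ra β γ)) (.single a 1) (treeOp b (succ β γ) t)
        - q • nodeB k (succ (la α β) γ) (treeOp a (prec α β) b) (.single t 1)
    else .single (node (succ δ γ) (node (succ α β) a b) t) 1
  | node (prec α β) a b, succ δ γ, t =>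
    .single (node (succ δ γ) (node (prec α β) a b) t) 1
  | leaf, e, t => .single (node e leaf t) 1

/-- The generators `e` and the root of `x` form the leading left comb of a relation. -/
def IsRedex : PBTree (FamilyGen Ω) → FamilyGen Ω → Prop
  | leaf, _ => False
  | node (prec α β) _ _, prec δ _ => δ = la α β
  | node (prec _ _) _ _, succ _ _ => False
  | node (succ α β) _ _, prec δ _ => δ = ra α β
  | node (succ α β) _ _, succ δ _ => δ = ra α β

theorem treeOp_of_not_isRedex {x : PBTree (FamilyGen Ω)} {e : FamilyGen Ω}
    (h : ¬ IsRedex la ra x e) (t : PBTree (FamilyGen Ω)) :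
    treeOp la ra q x e t = .single (node e x t) 1 := by
  rcases x with _ | ⟨_ | _, a, b⟩ <;> rcases e with _ | _ <;> simp_all [treeOp, IsRedex]

/-- The bilinear extension of `treeOp`. -/
noncomputable def mul (e : FamilyGen Ω) :
    Span k (FamilyGen Ω) →ₗ[k] Span k (FamilyGen Ω) →ₗ[k] Span k (FamilyGen Ω) :=
  Finsupp.linearCombination k fun s => Finsupp.linearCombination k fun t => treeOp la ra q s e t

theorem mul_single (e : FamilyGen Ω) (s t : PBTree (FamilyGen Ω)) (a b : k) :
    mul la ra q e (.single s a) (.single t b) = (a * b) • treeOp la ra q s e t := by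
  simp [mul, mul_smul]

theorem mul_of_not_isRedex {x : PBTree (FamilyGen Ω)} {e : FamilyGen Ω}
    (h : ¬ IsRedex la ra x e) (z : Span k (FamilyGen Ω)) :
    mul la ra q e (.single x 1) z = nodeB k e (.single x 1) z := by
  induction z using Finsupp.induction_linear with
  | zero => simp
  | add y z hy hz => rw [map_add, map_add, hy, hz]
  | single t a => simp [mul_single, nodeB_single, treeOp_of_not_isRedex la ra q h]

theorem prec_mul_node_prec (α β γ : Ω) (u y z : Span k (FamilyGen Ω)) :
    mul la ra q (prec (la α β) γ) (nodeB k (prec α β) u y) z =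
      nodeB k (prec α (la β γ)) u (mul la ra q (prec β γ) y z)
        + q • nodeB k (prec α (ra β γ)) u (mul la ra q (succ β γ) y z) := by
  induction u using Finsupp.induction_linear with
  | zero => simp
  | add y z hy hz => simp only [map_add, LinearMap.add_apply, hy, hz, smul_add]; abel
  | single s a =>
  induction y using Finsupp.induction_linear with
  | zero => simp
  | add y z hy hz => simp only [map_add, LinearMap.add_apply, hy, hz, smul_add]; abel
  | single t b =>
  induction z using Finsupp.induction_linear with
  | zero => simp
  | add y z hy hz => simp only [map_add, hy, hz, smul_add]; abel
  | single u c =>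
  rw [nodeB_single, mul_single, mul_single, mul_single, treeOp, if_pos rfl,
    ← mul_one a, ← smul_eq_mul a 1, ← Finsupp.smul_single]
  simp only [map_smul, LinearMap.smul_apply, smul_add, smul_smul, smul_eq_mul, mul_one]
  congr 2 <;> ring

theorem prec_mul_node_succ (α β γ : Ω) (u y z : Span k (FamilyGen Ω)) :
    mul la ra q (prec (ra α β) γ) (nodeB k (succ α β) u y) z =
      nodeB k (succ α (la β γ)) u (mul la ra q (prec β γ) y z) := by
  induction u using Finsupp.induction_linear with
  | zero => simp
  | add y z hy hz => simp only [map_add, LinearMap.add_apply, hy, hz]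
  | single s a =>
  induction y using Finsupp.induction_linear with
  | zero => simp
  | add y z hy hz => simp only [map_add, LinearMap.add_apply, hy, hz]
  | single t b =>
  induction z using Finsupp.induction_linear with
  | zero => simp
  | add y z hy hz => simp only [map_add, hy, hz]
  | single u c =>
  rw [nodeB_single, mul_single, mul_single, treeOp, if_pos rfl,
    ← mul_one a, ← smul_eq_mul a 1, ← Finsupp.smul_single]
  simp only [map_smul, LinearMap.smul_apply, smul_smul, smul_eq_mul, mul_one]
  congr 1; ring

theorem succ_mul_node_succ (α β γ : Ω) (u y z : Span k (FamilyGen Ω)) :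
    mul la ra q (succ (ra α β) γ) (nodeB k (succ α β) u y) z =
      nodeB k (succ α (ra β γ)) u (mul la ra q (succ β γ) y z)
        - q • nodeB k (succ (la α β) γ) (mul la ra q (prec α β) u y) z := by
  induction u using Finsupp.induction_linear with
  | zero => simp
  | add y z hy hz => simp only [map_add, LinearMap.add_apply, hy, hz, smul_add]; abel
  | single s a =>
  induction y using Finsupp.induction_linear with
  | zero => simp
  | add y z hy hz => simp only [map_add, LinearMap.add_apply, hy, hz, smul_add]; abel
  | single t b =>
  induction z using Finsupp.induction_linear with
  | zero => simp
  | add y z hy hz => simp only [map_add, hy, hz, smul_add]; abel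
  | single u c =>
  rw [nodeB_single, mul_single, mul_single, mul_single, treeOp, if_pos rfl,
    ← mul_one a, ← smul_eq_mul a 1, ← Finsupp.smul_single, ← mul_one c, ← smul_eq_mul c 1,
    ← Finsupp.smul_single]
  simp only [map_smul, LinearMap.smul_apply, smul_sub, smul_smul, smul_eq_mul, mul_one]
  congr 2 <;> ring

theorem succ_mul_node_prec (α β δ γ : Ω) (u y z : Span k (FamilyGen Ω)) :
    mul la ra q (succ δ γ) (nodeB k (prec α β) u y) z =
      nodeB k (succ δ γ) (nodeB k (prec α β) u y) z := by
  induction u using Finsupp.induction_linear with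
  | zero => simp
  | add y z hy hz => simp only [map_add, LinearMap.add_apply, hy, hz]
  | single s a =>
  induction y using Finsupp.induction_linear with
  | zero => simp
  | add y z hy hz => simp only [map_add, LinearMap.add_apply, hy, hz]
  | single t b =>
  induction z using Finsupp.induction_linear with
  | zero => simp
  | add y z hy hz => simp only [map_add, hy, hz]
  | single u c =>
  rw [nodeB_single, nodeB_single, mul_single, treeOp]
  simp

variable {la ra q}

/-- If `x` and `≻_{α,β}` form no redex, all the trees of `x ≺_{α,β} y` have a root `≺`. -/
theorem succ_mul_prec_mul {x : PBTree (FamilyGen Ω)} {α β : Ω} (h : ¬ IsRedex la ra x (succ α β))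
    (δ γ : Ω) (y z : Span k (FamilyGen Ω)) :
    mul la ra q (succ δ γ) (mul la ra q (prec α β) (.single x 1) y) z =
      nodeB k (succ δ γ) (mul la ra q (prec α β) (.single x 1) y) z := by
  by_cases h' : IsRedex la ra x (prec α β)
  · rcases x with _ | ⟨⟨α', β'⟩ | ⟨α', β'⟩, a, b⟩
    · exact h'.elim
    · obtain rfl : α = la α' β' := h'
      have e : Finsupp.single (node (prec α' β') a b) (1 : k)
        = nodeB k (prec α' β') (.single a 1) (.single b 1) := by simp [nodeB_single]
      rw [e, prec_mul_node_prec]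
      simp only [map_add, map_smul, LinearMap.add_apply, LinearMap.smul_apply, succ_mul_node_prec]
    · exact (h h').elim
  · rw [mul_of_not_isRedex la ra q h', succ_mul_node_prec]

variable (la ra q) in
/-- The relations of `twistedRelations`, with first argument `x`. -/
structure SatisfiesRelations (x : Span k (FamilyGen Ω)) : Prop where
  prec_prec : ∀ α β γ y z, mul la ra q (prec (la α β) γ) (mul la ra q (prec α β) x y) z =
    mul la ra q (prec α (la β γ)) x (mul la ra q (prec β γ) y z)
      + q • mul la ra q (prec α (ra β γ)) x (mul la ra q (succ β γ) y z)
  succ_prec : ∀ α β γ y z, mul la ra q (prec (ra α β) γ) (mul la ra q (succ α β) x y) z =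
    mul la ra q (succ α (la β γ)) x (mul la ra q (prec β γ) y z)
  succ_succ : ∀ α β γ y z, mul la ra q (succ (ra α β) γ) (mul la ra q (succ α β) x y) z =
    mul la ra q (succ α (ra β γ)) x (mul la ra q (succ β γ) y z)
      - q • mul la ra q (succ (la α β) γ) (mul la ra q (prec α β) x y) z

theorem prec_prec_of_not_isRedex {x : PBTree (FamilyGen Ω)} {α β : Ω}
    (h : ¬ IsRedex la ra x (prec α β)) (γ : Ω) (y z : Span k (FamilyGen Ω)) :
    mul la ra q (prec (la α β) γ) (mul la ra q (prec α β) (.single x 1) y) z =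
      mul la ra q (prec α (la β γ)) (.single x 1) (mul la ra q (prec β γ) y z)
        + q • mul la ra q (prec α (ra β γ)) (.single x 1) (mul la ra q (succ β γ) y z) := by
  have h' : ∀ δ, ¬ IsRedex la ra x (prec α δ) := fun δ => by
    rcases x with _ | ⟨_ | _, a, b⟩ <;> exact h
  rw [mul_of_not_isRedex _ _ _ h, mul_of_not_isRedex _ _ _ (h' _),
    mul_of_not_isRedex _ _ _ (h' _), prec_mul_node_prec]

theorem succ_prec_of_not_isRedex {x : PBTree (FamilyGen Ω)} {α β : Ω}
    (h : ¬ IsRedex la ra x (succ α β)) (γ : Ω) (y z : Span k (FamilyGen Ω)) :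
    mul la ra q (prec (ra α β) γ) (mul la ra q (succ α β) (.single x 1) y) z =
      mul la ra q (succ α (la β γ)) (.single x 1) (mul la ra q (prec β γ) y z) := by
  have h' : ∀ δ, ¬ IsRedex la ra x (succ α δ) := fun δ => by
    rcases x with _ | ⟨_ | _, a, b⟩ <;> exact h
  rw [mul_of_not_isRedex _ _ _ h, mul_of_not_isRedex _ _ _ (h' _), prec_mul_node_succ]

theorem succ_succ_of_not_isRedex {x : PBTree (FamilyGen Ω)} {α β : Ω}
    (h : ¬ IsRedex la ra x (succ α β)) (γ : Ω) (y z : Span k (FamilyGen Ω)) :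
    mul la ra q (succ (ra α β) γ) (mul la ra q (succ α β) (.single x 1) y) z =
      mul la ra q (succ α (ra β γ)) (.single x 1) (mul la ra q (succ β γ) y z)
        - q • mul la ra q (succ (la α β) γ) (mul la ra q (prec α β) (.single x 1) y) z := by
  have h' : ∀ δ, ¬ IsRedex la ra x (succ α δ) := fun δ => by
    rcases x with _ | ⟨_ | _, a, b⟩ <;> exact h
  rw [mul_of_not_isRedex _ _ _ h, mul_of_not_isRedex _ _ _ (h' _), succ_mul_node_succ,
    succ_mul_prec_mul h]

theorem satisfiesRelations_node_prec (H : TwistedSemigroup la ra q) (α₀ β₀ : Ω)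
    (a : PBTree (FamilyGen Ω)) {b : PBTree (FamilyGen Ω)}
    (hb : SatisfiesRelations la ra q (.single b 1)) :
    SatisfiesRelations la ra q (.single (node (prec α₀ β₀) a b) 1) where
  prec_prec α β γ y z := by
    by_cases h : α = la α₀ β₀
    · subst h
      have e : Finsupp.single (node (prec α₀ β₀) a b) (1 : k)
        = nodeB k (prec α₀ β₀) (.single a 1) (.single b 1) := by simp [nodeB_single]
      rw [e, prec_mul_node_prec, prec_mul_node_prec, prec_mul_node_prec]
      rcases H.twist with rfl | ⟨rfl, hl, hr⟩
      · simp only [zero_smul, add_zero]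
        rw [H.la_la, prec_mul_node_prec, hb.prec_prec, H.la_la]
        simp
      · simp only [one_smul, map_add, LinearMap.add_apply]
        rw [H.la_la, prec_mul_node_prec, ← hl, prec_mul_node_prec, hb.prec_prec, hb.succ_prec,
          hb.succ_succ, H.la_la, hl, H.ra_la, H.ra_ra, hr]
        simp only [one_smul, map_add, map_sub]
        abel
    · exact prec_prec_of_not_isRedex (by exact h) γ y z
  succ_prec α β := succ_prec_of_not_isRedex (by exact id)
  succ_succ α β := succ_succ_of_not_isRedex (by exact id)

theorem satisfiesRelations_node_succ (H : TwistedSemigroup la ra q) (α₀ β₀ : Ω)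
    {a b : PBTree (FamilyGen Ω)} (ha : SatisfiesRelations la ra q (.single a 1))
    (hb : SatisfiesRelations la ra q (.single b 1)) :
    SatisfiesRelations la ra q (.single (node (succ α₀ β₀) a b) 1) := by
  have e : Finsupp.single (node (succ α₀ β₀) a b) (1 : k)
    = nodeB k (succ α₀ β₀) (.single a 1) (.single b 1) := by simp [nodeB_single]
  constructor <;> intro α β γ y z
  · by_cases h : α = ra α₀ β₀
    · subst h
      rw [e, prec_mul_node_succ, prec_mul_node_succ, prec_mul_node_succ, H.ra_la,
        prec_mul_node_succ, hb.prec_prec, H.la_la, map_add, map_smul]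
      rcases H.twist with rfl | ⟨rfl, hl, hr⟩
      · simp
      · rw [hl]
    · exact prec_prec_of_not_isRedex (by exact h) γ y z
  · by_cases h : α = ra α₀ β₀
    · subst h
      rw [e, succ_mul_node_succ, succ_mul_node_succ, map_sub, map_smul, LinearMap.sub_apply,
        LinearMap.smul_apply, H.ra_ra, prec_mul_node_succ, hb.succ_prec, H.ra_la]
      rcases H.twist with rfl | ⟨rfl, hl, hr⟩
      · simp
      · rw [← hr, prec_mul_node_succ]
    · exact succ_prec_of_not_isRedex (by exact h) γ y z
  · by_cases h : α = ra α₀ β₀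
    · subst h
      rw [e, succ_mul_node_succ, succ_mul_node_succ, prec_mul_node_succ]
      rcases H.twist with rfl | ⟨rfl, hl, hr⟩
      · simp only [zero_smul, sub_zero]
        rw [H.ra_ra, succ_mul_node_succ, hb.succ_succ, H.ra_ra]
        simp
      · simp only [one_smul, map_sub, LinearMap.sub_apply]
        rw [H.ra_ra, succ_mul_node_succ, ← hr, succ_mul_node_succ, H.ra_la, succ_mul_node_succ,
          hb.succ_succ, ha.prec_prec, H.ra_ra, hr]
        simp only [one_smul, map_add, map_sub, LinearMap.add_apply, hl, H.la_la]
        abel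
    · exact succ_succ_of_not_isRedex (by exact h) γ y z

theorem satisfiesRelations_single (H : TwistedSemigroup la ra q) (x : PBTree (FamilyGen Ω)) :
    SatisfiesRelations la ra q (.single x (1 : k)) := by
  induction x with
  | leaf => exact ⟨fun α β => prec_prec_of_not_isRedex id, fun α β => succ_prec_of_not_isRedex id,
      fun α β => succ_succ_of_not_isRedex id⟩
  | node e a b iha ihb =>
    rcases e with ⟨α, β⟩ | ⟨α, β⟩
    · exact satisfiesRelations_node_prec H α β a ihb
    · exact satisfiesRelations_node_succ H α β iha ihb

theorem satisfiesRelations (H : TwistedSemigroup la ra q) (x : Span k (FamilyGen Ω)) :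
    SatisfiesRelations la ra q x := by
  induction x using Finsupp.induction_linear with
  | zero => constructor <;> simp
  | add x x' h h' =>
    constructor <;> intro α β γ y z <;> simp only [map_add, LinearMap.add_apply]
    · rw [h.prec_prec, h'.prec_prec, smul_add]; abel
    · rw [h.succ_prec, h'.succ_prec]
    · rw [h.succ_succ, h'.succ_succ, smul_add]; abel
  | single t c =>
    have h := satisfiesRelations_single H t
    rw [← mul_one c, ← smul_eq_mul, ← Finsupp.smul_single]
    constructor <;> intro α β γ y z <;> simp only [map_smul, LinearMap.smul_apply]
    · rw [h.prec_prec, smul_add, smul_comm c q]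
    · rw [h.succ_prec]
    · rw [h.succ_succ, smul_sub, smul_comm c q]

end Product

namespace PBTree

/-- The normal trees: no left comb in them is the leading one of a relation. -/
def Normal {Ω : Type*} (la ra : Ω → Ω → Ω) : PBTree (FamilyGen Ω) → Prop
  | leaf => True
  | node e l r => l.Normal la ra ∧ r.Normal la ra ∧ ¬ IsRedex la ra l e

end PBTree

theorem NSOperad.Ideal.subset_span {k : Type*} [Field k] (P : NSOperad k) {d : ℕ}
    (S : Set (P.obj d)) : S ⊆ (NSOperad.Ideal.span P S).carrier d := by
  intro f hf
  simp only [NSOperad.Ideal.span, SetLike.mem_coe, Submodule.mem_iInf]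
  exact fun J hJ => hJ hf

section Evaluation

variable {k : Type*} [Field k] {Ω : Type*} (la ra : Ω → Ω → Ω) (q : k)

/-- The value of the tree `t` at the arguments `v 0, v 1, …` in the free algebra on one
generator. -/
noncomputable def eval : PBTree (FamilyGen Ω) → (ℕ → Span k (FamilyGen Ω)) → Span k (FamilyGen Ω)
  | leaf, v => v 0
  | node e l r, v => mul la ra q e (eval l v) (eval r fun i => v (i + l.leaves))

/-- The linear extension of `eval`. -/
noncomputable def evalₗ (n : ℕ) (v : ℕ → Span k (FamilyGen Ω)) :
    FreeObj k (FamilyGen Ω) n →ₗ[k] Span k (FamilyGen Ω) :=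
  Finsupp.linearCombination k fun t => eval la ra q t.1 v

theorem evalₗ_single (n : ℕ) (v : ℕ → Span k (FamilyGen Ω))
    (t : {t : PBTree (FamilyGen Ω) // t.leaves = n}) (c : k) :
    evalₗ la ra q n v (.single t c) = c • eval la ra q t.1 v := by
  simp [evalₗ]

theorem eval_congr (t : PBTree (FamilyGen Ω)) (v v' : ℕ → Span k (FamilyGen Ω))
    (h : ∀ j < t.leaves, v j = v' j) : eval la ra q t v = eval la ra q t v' := by
  induction t generalizing v v' with
  | leaf => exact h 0 (by simp [leaves])
  | node e l r ihl ihr =>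
    simp only [leaves] at h
    rw [eval, eval, ihl v v' fun j hj => h j (by omega), ihr _ _ fun j hj => h _ (by omega)]

theorem eval_graft (s t : PBTree (FamilyGen Ω)) (i : ℕ) (hi : i < s.leaves)
    (v : ℕ → Span k (FamilyGen Ω)) :
    eval la ra q (s.graft i t) v = eval la ra q s fun j =>
      if j < i then v j else if j = i then eval la ra q t fun m => v (m + i)
      else v (j + t.leaves - 1) := by
  induction s generalizing i v with
  | leaf =>
    obtain rfl : i = 0 := by simpa [leaves] using hi
    simp [graft, eval]
  | node e l r ihl ihr =>
    simp only [leaves] at hi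
    rw [graft]
    split_ifs with h
    · have := leaves_graft l t i h
      rw [eval, eval, ihl i h]
      congr 2
      funext j
      rw [if_neg (by omega), if_neg (by omega)]
      congr 1
      omega
    · rw [eval, eval, ihr (i - l.leaves) (by omega)]
      congr 1
      · congr 1
        exact eval_congr _ _ _ _ _ _ fun j hj => by rw [if_pos (by omega)]
      · congr 1
        funext j
        by_cases h₁ : j + l.leaves < i
        · rw [if_pos h₁, if_pos (by omega)]
        · by_cases h₂ : j + l.leaves = i
          · rw [if_neg h₁, if_neg (by omega), if_pos h₂, if_pos (by omega)]
            congr 1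
            funext m
            congr 1
            omega
          · rw [if_neg h₁, if_neg (by omega), if_neg h₂, if_neg (by omega)]
            congr 1
            omega

/-- An element vanishing identically still does so when plugged into a tree. -/
theorem eval_graft_eq_zero {n : ℕ} (y : FreeObj k (FamilyGen Ω) n)
    (hy : ∀ v, evalₗ la ra q n v y = 0) (s : PBTree (FamilyGen Ω)) (i : ℕ) (hi : i < s.leaves)
    (v : ℕ → Span k (FamilyGen Ω)) :
    Finsupp.linearCombination k (fun t : {t : PBTree (FamilyGen Ω) // t.leaves = n} =>
      eval la ra q (s.graft i t.1) v) y = 0 := by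
  induction s generalizing i v with
  | leaf => exact hy v
  | node e l r ihl ihr =>
    simp only [leaves] at hi
    by_cases h : i < l.leaves
    · have key : (fun t : {t : PBTree (FamilyGen Ω) // t.leaves = n} =>
          eval la ra q ((node e l r).graft i t.1) v) = (mul la ra q e).flip
            (eval la ra q r fun j => v (j + (l.leaves + n - 1))) ∘
            fun t => eval la ra q (l.graft i t.1) v := by
        funext t
        have := leaves_graft l t.1 i h
        have ht := t.2
        simp only [graft, if_pos h, eval, Function.comp_apply, LinearMap.flip_apply]
        congr 3
        funext j
        congr 1
        omega
      rw [key, ← Finsupp.apply_linearCombination, ihl i h, map_zero]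
    · have key : (fun t : {t : PBTree (FamilyGen Ω) // t.leaves = n} =>
          eval la ra q ((node e l r).graft i t.1) v) = mul la ra q e (eval la ra q l v) ∘
            fun t => eval la ra q (r.graft (i - l.leaves) t.1) fun j => v (j + l.leaves) := by
        funext t
        simp only [graft, if_neg h, eval, Function.comp_apply]
      rw [key, ← Finsupp.apply_linearCombination, ihr _ (by omega), map_zero]

theorem evalₗ_freeComp_left {m n p : ℕ} (i : ℕ) (hi : i < m) (h : m + n = p + 1)
    (x : FreeObj k (FamilyGen Ω) m) (y : FreeObj k (FamilyGen Ω) n)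
    (hx : ∀ v, evalₗ la ra q m v x = 0) (v : ℕ → Span k (FamilyGen Ω)) :
    evalₗ la ra q p v (freeComp k _ i hi h x y) = 0 := by
  induction y using Finsupp.induction_linear with
  | zero => rw [map_zero, map_zero]
  | add y z hy hz => rw [map_add, map_add, hy, hz, add_zero]
  | single t b =>
    have key : (evalₗ la ra q p v) ∘ₗ (freeComp k _ i hi h).flip (.single t b) =
        b • evalₗ la ra q m (fun j => if j < i then v j
          else if j = i then eval la ra q t.1 fun m => v (m + i)
          else v (j + t.1.leaves - 1)) := by
      refine Finsupp.lhom_ext fun s a => ?_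
      have := leaves_graft s.1 t.1 i (s.2.symm ▸ hi)
      have hs := s.2
      have ht := t.2
      rw [LinearMap.comp_apply, LinearMap.flip_apply, LinearMap.smul_apply,
        freeComp_single k _ i hi h s t a b (by omega), evalₗ_single, evalₗ_single,
        eval_graft _ _ _ _ _ _ (by omega), smul_smul, mul_comm]
    have := LinearMap.congr_fun key x
    rwa [LinearMap.smul_apply, hx, smul_zero] at this

theorem evalₗ_freeComp_right {m n p : ℕ} (i : ℕ) (hi : i < m) (h : m + n = p + 1)
    (x : FreeObj k (FamilyGen Ω) m) (y : FreeObj k (FamilyGen Ω) n)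
    (hy : ∀ v, evalₗ la ra q n v y = 0) (v : ℕ → Span k (FamilyGen Ω)) :
    evalₗ la ra q p v (freeComp k _ i hi h x y) = 0 := by
  induction x using Finsupp.induction_linear with
  | zero => rw [map_zero, LinearMap.zero_apply, map_zero]
  | add x z hx hz => rw [map_add, LinearMap.add_apply, map_add, hx, hz, add_zero]
  | single s a =>
    have key : (evalₗ la ra q p v) ∘ₗ (freeComp k _ i hi h (.single s a)) =
        a • Finsupp.linearCombination k
          (fun t : {t : PBTree (FamilyGen Ω) // t.leaves = n} =>
            eval la ra q (s.1.graft i t.1) v) := by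
      refine Finsupp.lhom_ext fun t b => ?_
      have := leaves_graft s.1 t.1 i (s.2.symm ▸ hi)
      have hs := s.2
      have ht := t.2
      rw [LinearMap.comp_apply, LinearMap.smul_apply,
        freeComp_single k _ i hi h s t a b (by omega), evalₗ_single,
        Finsupp.linearCombination_single, smul_smul]
    have := LinearMap.congr_fun key y
    rwa [LinearMap.smul_apply, eval_graft_eq_zero la ra q y hy s.1 i (s.2.symm ▸ hi),
      smul_zero] at this

/-- The elements of arity `n` vanishing identically on the free algebra on one generator. -/
noncomputable def vanishing (n : ℕ) : Submodule k (FreeObj k (FamilyGen Ω) n) :=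
  ⨅ v, LinearMap.ker (evalₗ la ra q n v)

theorem mem_vanishing {n : ℕ} {x : FreeObj k (FamilyGen Ω) n} :
    x ∈ vanishing la ra q n ↔ ∀ v, evalₗ la ra q n v x = 0 := by
  simp [vanishing]

/-- The operadic ideal of the elements vanishing identically on the free algebra on one
generator. -/
noncomputable def vanishingIdeal : (freeOperad k (FamilyGen Ω)).Ideal where
  carrier n := vanishing la ra q n
  comp_mem_left i hi h x y hx := (mem_vanishing la ra q).2
    (evalₗ_freeComp_left la ra q i hi h x y ((mem_vanishing la ra q).1 hx))
  comp_mem_right i hi h x y hy := (mem_vanishing la ra q).2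
    (evalₗ_freeComp_right la ra q i hi h x y ((mem_vanishing la ra q).1 hy))

/-- The tree `(x e y) f z` as an element of the free operad. -/
noncomputable abbrev leftTree (k : Type*) [Field k] (e f : FamilyGen Ω) :
    FreeObj k (FamilyGen Ω) 3 :=
  .single ⟨node f (node e leaf leaf) leaf, rfl⟩ 1

/-- The tree `x e (y f z)` as an element of the free operad. -/
noncomputable abbrev rightTree (k : Type*) [Field k] (e f : FamilyGen Ω) :
    FreeObj k (FamilyGen Ω) 3 :=
  .single ⟨node e leaf (node f leaf leaf), rfl⟩ 1

theorem leftComb_eq (e f : FamilyGen Ω) : leftComb k e f = leftTree k e f := by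
  have := freeComp_single k (FamilyGen Ω) (m := 2) (n := 2) (p := 3) 0 (by omega) rfl
    ⟨node f leaf leaf, rfl⟩ ⟨node e leaf leaf, rfl⟩ 1 1 rfl
  rw [mul_one] at this
  exact this

theorem rightComb_eq (e f : FamilyGen Ω) : rightComb k e f = rightTree k e f := by
  have := freeComp_single k (FamilyGen Ω) (m := 2) (n := 2) (p := 3) 1 (by omega) rfl
    ⟨node e leaf leaf, rfl⟩ ⟨node f leaf leaf, rfl⟩ 1 1 rfl
  rw [mul_one] at this
  exact this

/-- The relations, in terms of trees. -/
def treeRelations : Set (FreeObj k (FamilyGen Ω) 3) :=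
  {f | ∃ α β γ : Ω,
    f = leftTree k (prec α β) (prec (la α β) γ)
        - (rightTree k (prec α (la β γ)) (prec β γ)
          + q • rightTree k (prec α (ra β γ)) (succ β γ)) ∨
    f = leftTree k (succ α β) (prec (ra α β) γ)
        - rightTree k (succ α (la β γ)) (prec β γ) ∨
    f = rightTree k (succ α (ra β γ)) (succ β γ)
        - (leftTree k (succ α β) (succ (ra α β) γ)
          + q • leftTree k (prec α β) (succ (la α β) γ))}

theorem twistedRelations_eq : twistedRelations k la ra q = treeRelations la ra q := by
  unfold twistedRelations
  simp only [leftComb_eq, rightComb_eq]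
  rfl

theorem evalₗ_leftTree (e f : FamilyGen Ω) (v : ℕ → Span k (FamilyGen Ω)) :
    evalₗ la ra q 3 v (leftTree k e f) =
      mul la ra q f (mul la ra q e (v 0) (v 1)) (v 2) := by
  rw [evalₗ_single]
  simp [eval, leaves]

theorem evalₗ_rightTree (e f : FamilyGen Ω) (v : ℕ → Span k (FamilyGen Ω)) :
    evalₗ la ra q 3 v (rightTree k e f) =
      mul la ra q e (v 0) (mul la ra q f (v 1) (v 2)) := by
  rw [evalₗ_single]
  simp [eval, leaves]

variable {la ra q}

theorem treeRelations_subset_vanishing (H : TwistedSemigroup la ra q) :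
    treeRelations la ra q ⊆ (vanishing la ra q 3 : Set (FreeObj k (FamilyGen Ω) 3)) := by
  rintro f ⟨α, β, γ, hf⟩
  refine (mem_vanishing la ra q).2 fun v => ?_
  have R := satisfiesRelations H (v 0)
  rcases hf with rfl | rfl | rfl
  · rw [map_sub, map_add, map_smul, evalₗ_leftTree, evalₗ_rightTree, evalₗ_rightTree,
      R.prec_prec, sub_self]
  · rw [map_sub, evalₗ_leftTree, evalₗ_rightTree, R.succ_prec, sub_self]
  · rw [map_sub, map_add, map_smul, evalₗ_leftTree, evalₗ_leftTree, evalₗ_rightTree,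
      R.succ_succ]
    abel

variable (la ra q) in
/-- The ideal of relations in arity `n`. -/
noncomputable def relationIdeal (n : ℕ) : Submodule k (FreeObj k (FamilyGen Ω) n) :=
  (NSOperad.Ideal.span (freeOperad k (FamilyGen Ω)) (twistedRelations k la ra q)).carrier n

theorem relationIdeal_le_vanishing (H : TwistedSemigroup la ra q) (n : ℕ) :
    relationIdeal la ra q n ≤ vanishing la ra q n := by
  refine iInf₂_le (vanishingIdeal la ra q) ?_
  rw [twistedRelations_eq]
  exact treeRelations_subset_vanishing H

theorem treeRelations_subset_relationIdeal {f : FreeObj k (FamilyGen Ω) 3}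
    (hf : f ∈ treeRelations la ra q) : f ∈ relationIdeal la ra q 3 := by
  rw [← twistedRelations_eq] at hf
  exact NSOperad.Ideal.subset_span _ _ hf

theorem freeComp_left_mem_relationIdeal {m n p : ℕ} (i : ℕ) (hi : i < m) (h : m + n = p + 1)
    {x : FreeObj k (FamilyGen Ω) m} (hx : x ∈ relationIdeal la ra q m)
    (y : FreeObj k (FamilyGen Ω) n) :
    freeComp k _ i hi h x y ∈ relationIdeal la ra q p :=
  (NSOperad.Ideal.span _ (twistedRelations k la ra q)).comp_mem_left i hi h x y hx

theorem freeComp_right_mem_relationIdeal {m n p : ℕ} (i : ℕ) (hi : i < m) (h : m + n = p + 1)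
    (x : FreeObj k (FamilyGen Ω) m) {y : FreeObj k (FamilyGen Ω) n}
    (hy : y ∈ relationIdeal la ra q n) :
    freeComp k _ i hi h x y ∈ relationIdeal la ra q p :=
  (NSOperad.Ideal.span _ (twistedRelations k la ra q)).comp_mem_right i hi h x y hy

end Evaluation

section Reduction

variable {k : Type*} [Field k] {Ω : Type*}

/-- The inclusion of the component of arity `n` of the free operad into the span of all trees. -/
noncomputable def toSpan {E : Type*} (n : ℕ) : FreeObj k E n →ₗ[k] Span k E :=
  Finsupp.lmapDomain k k Subtype.val

theorem toSpan_single {E : Type*} {n : ℕ} (t : {t : PBTree E // t.leaves = n}) (c : k) :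
    toSpan n (.single t c) = .single t.1 c := by
  simp [toSpan]

variable (la ra : Ω → Ω → Ω) (q : k)

/-- The span of the relations of all arities. -/
noncomputable def totalIdeal : Submodule k (Span k (FamilyGen Ω)) :=
  ⨆ n, (relationIdeal la ra q n).map (toSpan n)

variable {la ra q}

theorem toSpan_mem_totalIdeal {n : ℕ} {f : FreeObj k (FamilyGen Ω) n}
    (hf : f ∈ relationIdeal la ra q n) : toSpan n f ∈ totalIdeal la ra q :=
  Submodule.mem_iSup_of_mem n ⟨f, hf, rfl⟩

theorem totalIdeal_induction {V : Type*} [AddCommGroup V] [Module k V]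
    (g : Span k (FamilyGen Ω) →ₗ[k] V) (W : Submodule k V)
    (h : ∀ n, ∀ y ∈ relationIdeal la ra q n, g (toSpan n y) ∈ W)
    {f : Span k (FamilyGen Ω)} (hf : f ∈ totalIdeal la ra q) : g f ∈ W := by
  have : totalIdeal la ra q ≤ W.comap g := by
    refine iSup_le fun n => ?_
    rintro _ ⟨y, hy, rfl⟩
    exact h n y hy
  exact this hf

theorem nodeB_single_toSpan {E : Type*} (e : E) (s : PBTree E) {n : ℕ} (y : FreeObj k E n)
    (h : (s.leaves + 1) + n = (s.leaves + n) + 1) :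
    nodeB k e (.single s 1) (toSpan n y) = toSpan _ (freeComp k E s.leaves (by omega) h
      (.single ⟨node e s leaf, rfl⟩ 1) y) := by
  induction y using Finsupp.induction_linear with
  | zero => simp
  | add x y hx hy => simp only [map_add, hx, hy]
  | single t c =>
    have ht := t.2
    have e₀ : (node e s leaf).graft s.leaves t.1 = node e s t.1 := by simp [graft]
    have e₁ : ((node e s leaf).graft s.leaves t.1).leaves = s.leaves + n := by
      rw [e₀]; simp [leaves, ht]
    rw [freeComp_single k E _ _ h ⟨node e s leaf, rfl⟩ t 1 c e₁, toSpan_single, toSpan_single,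
      nodeB_single]
    simp only [e₀]

theorem nodeB_toSpan_single {E : Type*} (e : E) (t : PBTree E) {m : ℕ} (x : FreeObj k E m)
    (h : (1 + t.leaves) + m = (m + t.leaves) + 1) :
    nodeB k e (toSpan m x) (.single t 1) = toSpan _ (freeComp k E 0 (by omega) h
      (.single ⟨node e leaf t, rfl⟩ 1) x) := by
  induction x using Finsupp.induction_linear with
  | zero => simp
  | add x y hx hy => simp only [map_add, LinearMap.add_apply, hx, hy]
  | single s c =>
    have hs := s.2
    have e₀ : (node e leaf t).graft 0 s.1 = node e s.1 t := by simp [graft, leaves]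
    have e₁ : ((node e leaf t).graft 0 s.1).leaves = m + t.leaves := by
      rw [e₀]; simp [leaves, hs]
    rw [freeComp_single k E _ _ h ⟨node e leaf t, rfl⟩ s 1 c e₁, toSpan_single, toSpan_single,
      nodeB_single]
    simp only [e₀, mul_one, one_mul]

theorem nodeB_right_mem_totalIdeal (e : FamilyGen Ω) (x : Span k (FamilyGen Ω))
    {f : Span k (FamilyGen Ω)} (hf : f ∈ totalIdeal la ra q) :
    nodeB k e x f ∈ totalIdeal la ra q := by
  induction x using Finsupp.induction_linear with
  | zero => simp
  | add x y hx hy =>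
    rw [map_add, LinearMap.add_apply]
    exact Submodule.add_mem _ hx hy
  | single s a =>
    rw [← mul_one a, ← smul_eq_mul, ← Finsupp.smul_single, map_smul, LinearMap.smul_apply]
    refine Submodule.smul_mem _ _ (totalIdeal_induction _ _ (fun n y hy => ?_) hf)
    rw [nodeB_single_toSpan e s y (by omega)]
    exact toSpan_mem_totalIdeal (freeComp_right_mem_relationIdeal _ _ _ _ hy)

theorem nodeB_left_mem_totalIdeal (e : FamilyGen Ω) (x : Span k (FamilyGen Ω))
    {f : Span k (FamilyGen Ω)} (hf : f ∈ totalIdeal la ra q) :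
    nodeB k e f x ∈ totalIdeal la ra q := by
  induction x using Finsupp.induction_linear with
  | zero => simp
  | add x y hx hy =>
    rw [map_add]
    exact Submodule.add_mem _ hx hy
  | single s a =>
    rw [← mul_one a, ← smul_eq_mul, ← Finsupp.smul_single, map_smul]
    refine Submodule.smul_mem _ _
      (totalIdeal_induction ((nodeB k e).flip (.single s 1)) _ (fun n y hy => ?_) hf)
    rw [LinearMap.flip_apply, nodeB_toSpan_single e s y (by omega)]
    exact toSpan_mem_totalIdeal (freeComp_right_mem_relationIdeal _ _ _ _ hy)

theorem nodeB_smodEq (e : FamilyGen Ω) {x x' y y' : Span k (FamilyGen Ω)}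
    (hx : x ≡ x' [SMOD totalIdeal la ra q]) (hy : y ≡ y' [SMOD totalIdeal la ra q]) :
    nodeB k e x y ≡ nodeB k e x' y' [SMOD totalIdeal la ra q] := by
  rw [SModEq.sub_mem] at hx hy ⊢
  have : nodeB k e x y - nodeB k e x' y' = nodeB k e (x - x') y + nodeB k e x' (y - y') := by
    simp
  rw [this]
  exact Submodule.add_mem _ (nodeB_left_mem_totalIdeal e _ hx) (nodeB_right_mem_totalIdeal e _ hy)

/-- The linear extension of `fun s => s.graft i t`. -/
noncomputable def graftₗ (k : Type*) [Field k] {E : Type*} (i : ℕ) (t : PBTree E) :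
    Span k E →ₗ[k] Span k E :=
  Finsupp.lmapDomain k k fun s => s.graft i t

theorem graftₗ_toSpan {E : Type*} (t : PBTree E) {m p : ℕ} (i : ℕ) (hi : i < m)
    (h : m + t.leaves = p + 1) (x : FreeObj k E m) :
    graftₗ k i t (toSpan m x) = toSpan p (freeComp k E i hi h x (.single ⟨t, rfl⟩ 1)) := by
  induction x using Finsupp.induction_linear with
  | zero => simp
  | add x y hx hy => simp only [map_add, LinearMap.add_apply, hx, hy]
  | single s c =>
    have hs := s.2
    have := leaves_graft s.1 t i (by omega)
    rw [freeComp_single k E i hi h s ⟨t, rfl⟩ c 1 (by simp only; omega), toSpan_single,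
      toSpan_single, mul_one]
    simp [graftₗ]

/-- Substitution of trees for the three arguments of an operation of arity `3`. -/
noncomputable def substitute {E : Type*} (a b c : PBTree E) : FreeObj k E 3 →ₗ[k] Span k E :=
  graftₗ k 0 a ∘ₗ graftₗ k 1 b ∘ₗ graftₗ k 2 c ∘ₗ toSpan 3

theorem substitute_single {E : Type*} (a b c : PBTree E)
    (s : {t : PBTree E // t.leaves = 3}) :
    substitute (k := k) a b c (.single s 1) =
      .single (((s.1.graft 2 c).graft 1 b).graft 0 a) 1 := by
  simp [substitute, graftₗ, toSpan]

theorem substitute_leftTree (a b c : PBTree (FamilyGen Ω)) (e f : FamilyGen Ω) :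
    substitute a b c (leftTree k e f) = .single (node f (node e a b) c) 1 := by
  rw [substitute_single]
  simp [graft, leaves]

theorem substitute_rightTree (a b c : PBTree (FamilyGen Ω)) (e f : FamilyGen Ω) :
    substitute a b c (rightTree k e f) = .single (node e a (node f b c)) 1 := by
  rw [substitute_single]
  simp [graft, leaves]

theorem substitute_mem_totalIdeal (a b c : PBTree (FamilyGen Ω))
    {f : FreeObj k (FamilyGen Ω) 3} (hf : f ∈ treeRelations la ra q) :
    substitute a b c f ∈ totalIdeal la ra q := by
  simp only [substitute, LinearMap.comp_apply]
  rw [graftₗ_toSpan c (p := 2 + c.leaves) 2 (by omega) (by omega),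
    graftₗ_toSpan b (p := 1 + c.leaves + b.leaves) 1 (by omega) (by omega),
    graftₗ_toSpan a (p := c.leaves + b.leaves + a.leaves) 0 (by omega) (by omega)]
  exact toSpan_mem_totalIdeal (freeComp_left_mem_relationIdeal _ _ _
    (freeComp_left_mem_relationIdeal _ _ _ (freeComp_left_mem_relationIdeal _ _ _
      (treeRelations_subset_relationIdeal hf) _) _) _)

theorem prec_node_prec_smodEq (α β γ : Ω) (a b c : PBTree (FamilyGen Ω)) :
    Finsupp.single (node (prec (la α β) γ) (node (prec α β) a b) c) 1 ≡
      .single (node (prec α (la β γ)) a (node (prec β γ) b c)) 1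
        + q • .single (node (prec α (ra β γ)) a (node (succ β γ) b c)) 1
      [SMOD totalIdeal la ra q] := by
  have := substitute_mem_totalIdeal (la := la) (ra := ra) (q := q) a b c ⟨α, β, γ, .inl rfl⟩
  rwa [map_sub, map_add, map_smul, substitute_leftTree, substitute_rightTree,
    substitute_rightTree, ← SModEq.sub_mem] at this

theorem prec_node_succ_smodEq (α β γ : Ω) (a b c : PBTree (FamilyGen Ω)) :
    Finsupp.single (node (prec (ra α β) γ) (node (succ α β) a b) c) 1 ≡
      .single (node (succ α (la β γ)) a (node (prec β γ) b c)) 1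
      [SMOD totalIdeal la ra q] := by
  have := substitute_mem_totalIdeal (la := la) (ra := ra) (q := q) a b c ⟨α, β, γ, .inr (.inl rfl)⟩
  rwa [map_sub, substitute_leftTree, substitute_rightTree, ← SModEq.sub_mem] at this

theorem succ_node_succ_smodEq (α β γ : Ω) (a b c : PBTree (FamilyGen Ω)) :
    Finsupp.single (node (succ (ra α β) γ) (node (succ α β) a b) c) 1 ≡
      .single (node (succ α (ra β γ)) a (node (succ β γ) b c)) 1
        - q • .single (node (succ (la α β) γ) (node (prec α β) a b) c) 1
      [SMOD totalIdeal la ra q] := by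
  have := substitute_mem_totalIdeal (la := la) (ra := ra) (q := q) a b c ⟨α, β, γ, .inr (.inr rfl)⟩
  rw [map_sub, map_add, map_smul, substitute_leftTree, substitute_rightTree,
    substitute_leftTree, ← SModEq.sub_mem] at this
  rw [SModEq.sub_mem] at this ⊢
  rw [← Submodule.neg_mem_iff]
  convert this using 1
  abel

theorem node_smodEq_treeOp (s : PBTree (FamilyGen Ω)) (e : FamilyGen Ω)
    (t : PBTree (FamilyGen Ω)) :
    Finsupp.single (node e s t) 1 ≡ treeOp la ra q s e t [SMOD totalIdeal la ra q] := by
  induction s generalizing e t with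
  | leaf => rw [treeOp]
  | node e' a b iha ihb =>
    have hn : ∀ (f : FamilyGen Ω) (s t : PBTree (FamilyGen Ω)),
        Finsupp.single (node f s t) (1 : k) = nodeB k f (.single s 1) (.single t 1) := by
      simp [nodeB_single]
    by_cases h : IsRedex la ra (node e' a b) e
    · rcases e' with ⟨α, β⟩ | ⟨α, β⟩ <;> rcases e with ⟨δ, γ⟩ | ⟨δ, γ⟩
      · obtain rfl : δ = la α β := h
        rw [treeOp, if_pos rfl]
        refine (prec_node_prec_smodEq α β γ a b t).trans ?_
        rw [hn, hn _ a]
        exact (nodeB_smodEq _ (SModEq.refl _) (ihb _ _)).add ((nodeB_smodEq _ (SModEq.refl _) (ihb _ _)).smul q)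
      · exact h.elim
      · obtain rfl : δ = ra α β := h
        rw [treeOp, if_pos rfl]
        refine (prec_node_succ_smodEq α β γ a b t).trans ?_
        rw [hn]
        exact nodeB_smodEq _ (SModEq.refl _) (ihb _ _)
      · obtain rfl : δ = ra α β := h
        rw [treeOp, if_pos rfl]
        refine (succ_node_succ_smodEq α β γ a b t).trans ?_
        rw [hn (succ α (ra β γ)), hn (succ (la α β) γ)]
        exact (nodeB_smodEq _ (SModEq.refl _) (ihb _ _)).sub
          ((nodeB_smodEq _ (iha _ _) (SModEq.refl _)).smul q)
    · rw [treeOp_of_not_isRedex _ _ _ h]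

theorem nodeB_smodEq_mul (e : FamilyGen Ω) (x y : Span k (FamilyGen Ω)) :
    nodeB k e x y ≡ mul la ra q e x y [SMOD totalIdeal la ra q] := by
  induction x using Finsupp.induction_linear with
  | zero => simp
  | add x x' hx hx' => simpa only [map_add, LinearMap.add_apply] using hx.add hx'
  | single s a =>
  induction y using Finsupp.induction_linear with
  | zero => simp
  | add y y' hy hy' => simpa only [map_add] using hy.add hy'
  | single t b =>
    rw [nodeB_single, mul_single, ← mul_one (a * b), ← smul_eq_mul, ← Finsupp.smul_single,
      smul_eq_mul, mul_one]
    exact (node_smodEq_treeOp s e t).smul _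

variable (la ra q) in
/-- The normal form of a tree. -/
noncomputable def normalForm (t : PBTree (FamilyGen Ω)) : Span k (FamilyGen Ω) :=
  eval la ra q t fun _ => .single leaf 1

theorem normalForm_node (e : FamilyGen Ω) (l r : PBTree (FamilyGen Ω)) :
    normalForm la ra q (node e l r) =
      mul la ra q e (normalForm la ra q l) (normalForm la ra q r) := rfl

theorem single_smodEq_normalForm (t : PBTree (FamilyGen Ω)) :
    Finsupp.single t 1 ≡ normalForm la ra q t [SMOD totalIdeal la ra q] := by
  induction t with
  | leaf => exact .rfl
  | node e l r ihl ihr =>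
    have : Finsupp.single (node e l r) (1 : k) = nodeB k e (.single l 1) (.single r 1) := by
      simp [nodeB_single]
    rw [this, normalForm_node]
    exact (nodeB_smodEq e ihl ihr).trans (nodeB_smodEq_mul _ _ _)

theorem normalForm_of_normal {t : PBTree (FamilyGen Ω)} (ht : t.Normal la ra) :
    normalForm la ra q t = .single t 1 := by
  induction t with
  | leaf => rfl
  | node e l r ihl ihr =>
    rw [normalForm_node, ihl ht.1, ihr ht.2.1, mul_single, treeOp_of_not_isRedex _ _ _ ht.2.2]
    simp

variable (k la ra) in
/-- The span of the normal trees with `n` leaves. -/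
noncomputable def normalSpan (n : ℕ) : Submodule k (Span k (FamilyGen Ω)) :=
  Finsupp.supported k k {t | t.Normal la ra ∧ t.leaves = n}

theorem bilinear_mem_of_supported {E : Type*} {U V : Set (PBTree E)}
    {W : Submodule k (Span k E)} (g : Span k E →ₗ[k] Span k E →ₗ[k] Span k E)
    (h : ∀ s ∈ U, ∀ t ∈ V, g (.single s 1) (.single t 1) ∈ W) {x y : Span k E}
    (hx : x ∈ Finsupp.supported k k U) (hy : y ∈ Finsupp.supported k k V) : g x y ∈ W := by
  rw [Finsupp.supported_eq_span_single] at hx hy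
  induction hx using Submodule.span_induction with
  | zero => simp
  | add x x' _ _ hx hx' => simpa only [map_add, LinearMap.add_apply] using W.add_mem hx hx'
  | smul c x _ hx => simpa only [map_smul, LinearMap.smul_apply] using W.smul_mem c hx
  | mem x hx =>
  obtain ⟨s, hs, rfl⟩ := hx
  induction hy using Submodule.span_induction with
  | zero => simp
  | add x x' _ _ hx hx' => simpa only [map_add] using W.add_mem hx hx'
  | smul c x _ hx => simpa only [map_smul] using W.smul_mem c hx
  | mem y hy =>
  obtain ⟨t, ht, rfl⟩ := hy
  exact h s hs t ht

theorem not_isRedex_prec {a : PBTree (FamilyGen Ω)} {α β : Ω} (h : ¬ IsRedex la ra a (prec α β))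
    (γ : Ω) : ¬ IsRedex la ra a (prec α γ) := by
  rcases a with _ | ⟨_ | _, _, _⟩ <;> exact h

theorem not_isRedex_succ {a : PBTree (FamilyGen Ω)} {α β : Ω} (h : ¬ IsRedex la ra a (succ α β))
    (γ : Ω) : ¬ IsRedex la ra a (succ α γ) := by
  rcases a with _ | ⟨_ | _, _, _⟩ <;> exact h

/-- If `a` and `≻_{α,β}` form no redex, all the trees of `a ≺_{α,β} b` have a root `≺`. -/
theorem treeOp_prec_mem {a : PBTree (FamilyGen Ω)} {α β : Ω}
    (h : ¬ IsRedex la ra a (succ α β)) (b : PBTree (FamilyGen Ω)) :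
    treeOp la ra q a (prec α β) b ∈
      Finsupp.supported k k {t | ∀ δ γ, ¬ IsRedex la ra t (succ δ γ)} := by
  by_cases h' : IsRedex la ra a (prec α β)
  · rcases a with _ | ⟨⟨α', β'⟩ | ⟨α', β'⟩, a₁, a₂⟩
    · exact h'.elim
    · obtain rfl : α = la α' β' := h'
      rw [treeOp, if_pos rfl]
      have key : ∀ (γ : Ω) (x y : Span k (FamilyGen Ω)), nodeB k (prec α' γ) x y ∈
          Finsupp.supported k k {t | ∀ δ γ, ¬ IsRedex la ra t (succ δ γ)} := by
        refine fun γ x y => bilinear_mem_of_supported (U := Set.univ) (V := Set.univ) _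
          (fun s _ t _ => ?_) (by simp) (by simp)
        rw [nodeB_single]
        exact Finsupp.single_mem_supported k _ fun _ _ => id
      exact Submodule.add_mem _ (key _ _ _) (Submodule.smul_mem _ _ (key _ _ _))
    · exact (h h').elim
  · rw [treeOp_of_not_isRedex _ _ _ h']
    exact Finsupp.single_mem_supported k _ fun _ _ => id

theorem nodeB_mem_normalSpan {a : PBTree (FamilyGen Ω)} (ha : a.Normal la ra)
    {e : FamilyGen Ω} (h : ¬ IsRedex la ra a e) {n p : ℕ} (hp : a.leaves + n = p)
    {y : Span k (FamilyGen Ω)} (hy : y ∈ normalSpan k la ra n) :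
    nodeB k e (.single a 1) y ∈ normalSpan k la ra p := by
  refine bilinear_mem_of_supported (U := {a}) _ ?_ (Finsupp.single_mem_supported k _ rfl) hy
  rintro _ rfl t ⟨ht, htn⟩
  rw [nodeB_single]
  exact Finsupp.single_mem_supported k _ ⟨⟨ha, ht, h⟩, by rw [leaves, htn, hp]⟩

theorem treeOp_mem_normalSpan {s t : PBTree (FamilyGen Ω)} (hs : s.Normal la ra)
    (ht : t.Normal la ra) (e : FamilyGen Ω) :
    treeOp la ra q s e t ∈ normalSpan k la ra (s.leaves + t.leaves) := by
  induction s generalizing e t with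
  | leaf => exact Finsupp.single_mem_supported k _ ⟨⟨hs, ht, id⟩, rfl⟩
  | node e' a b iha ihb =>
    by_cases h : IsRedex la ra (node e' a b) e
    · obtain ⟨ha, hb, hab⟩ := hs
      have hl : a.leaves + (b.leaves + t.leaves) = (node e' a b).leaves + t.leaves := by
        simp only [leaves]; omega
      rcases e' with ⟨α, β⟩ | ⟨α, β⟩ <;> rcases e with ⟨δ, γ⟩ | ⟨δ, γ⟩
      · obtain rfl : δ = la α β := h
        rw [treeOp, if_pos rfl]
        exact Submodule.add_mem _
          (nodeB_mem_normalSpan ha (not_isRedex_prec hab _) hl (ihb hb ht _))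
          (Submodule.smul_mem _ _
            (nodeB_mem_normalSpan ha (not_isRedex_prec hab _) hl (ihb hb ht _)))
      · exact h.elim
      · obtain rfl : δ = ra α β := h
        rw [treeOp, if_pos rfl]
        exact nodeB_mem_normalSpan ha (not_isRedex_succ hab _) hl (ihb hb ht _)
      · obtain rfl : δ = ra α β := h
        rw [treeOp, if_pos rfl]
        refine Submodule.sub_mem _
          (nodeB_mem_normalSpan ha (not_isRedex_succ hab _) hl (ihb hb ht _))
          (Submodule.smul_mem _ _ ?_)
        have h₁ := iha ha hb (prec α β)
        have h₂ := treeOp_prec_mem (q := q) hab b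
        refine bilinear_mem_of_supported (V := {t}) _ ?_
          (show _ ∈ Finsupp.supported k k (_ ∩ _) by
            rw [Finsupp.supported_inter]; exact ⟨h₁, h₂⟩)
          (Finsupp.single_mem_supported k _ rfl)
        rintro u ⟨⟨hu, hul⟩, hur⟩ _ rfl
        rw [nodeB_single]
        exact Finsupp.single_mem_supported k _ ⟨⟨hu, ht, hur _ _⟩, by simp only [leaves, hul]⟩
    · rw [treeOp_of_not_isRedex _ _ _ h]
      exact Finsupp.single_mem_supported k _ ⟨⟨hs, ht, h⟩, rfl⟩

theorem normalForm_mem_normalSpan (t : PBTree (FamilyGen Ω)) :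
    normalForm la ra q t ∈ normalSpan k la ra t.leaves := by
  induction t with
  | leaf => exact Finsupp.single_mem_supported k _ ⟨trivial, rfl⟩
  | node e l r ihl ihr =>
    rw [normalForm_node]
    refine bilinear_mem_of_supported _ ?_ ihl ihr
    rintro s ⟨hs, hsl⟩ t ⟨ht, htl⟩
    rw [mul_single, leaves, ← hsl, ← htl]
    exact Submodule.smul_mem _ _ (treeOp_mem_normalSpan hs ht e)

variable (k la ra q) in
/-- The class modulo the relations of a combination of normal trees with `n` leaves. -/
noncomputable def normalClass (n : ℕ) :
    ({t : PBTree (FamilyGen Ω) // t.Normal la ra ∧ t.leaves = n} →₀ k) →ₗ[k]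
      (FreeObj k (FamilyGen Ω) n ⧸ relationIdeal la ra q n) :=
  (relationIdeal la ra q n).mkQ ∘ₗ Finsupp.lmapDomain k k fun t => ⟨t.1, t.2.2⟩

theorem normalClass_injective (H : TwistedSemigroup la ra q) (n : ℕ) :
    Function.Injective (normalClass k la ra q n) := by
  rw [← LinearMap.ker_eq_bot, LinearMap.ker_eq_bot']
  intro f hf
  rw [normalClass, LinearMap.comp_apply, Submodule.mkQ_apply, Submodule.Quotient.mk_eq_zero] at hf
  have h := (mem_vanishing la ra q).1 (relationIdeal_le_vanishing H n hf) fun _ => .single leaf 1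
  have key : evalₗ la ra q n (fun _ => .single leaf 1) ∘ₗ Finsupp.lmapDomain k k
      (fun t : {t : PBTree (FamilyGen Ω) // t.Normal la ra ∧ t.leaves = n} =>
        (⟨t.1, t.2.2⟩ : {t : PBTree (FamilyGen Ω) // t.leaves = n})) =
      Finsupp.lmapDomain k k Subtype.val := by
    refine Finsupp.lhom_ext fun t c => ?_
    have := normalForm_of_normal (k := k) (q := q) t.2.1
    rw [normalForm] at this
    simp [evalₗ_single, this]
  rw [← LinearMap.comp_apply, key] at h
  exact Finsupp.mapDomain_injective Subtype.val_injective (h.trans Finsupp.mapDomain_zero.symm)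

/-- The projection of the span of all trees onto the component of arity `n`. -/
noncomputable def ofSpan (k : Type*) [Field k] {E : Type*} (n : ℕ) :
    Span k E →ₗ[k] FreeObj k E n :=
  Finsupp.lcomapDomain Subtype.val Subtype.val_injective

theorem ofSpan_toSpan {E : Type*} (n : ℕ) (f : FreeObj k E n) : ofSpan k n (toSpan n f) = f :=
  Finsupp.comapDomain_mapDomain _ Subtype.val_injective f

theorem ofSpan_toSpan_of_ne {E : Type*} {m n : ℕ} (h : m ≠ n) (f : FreeObj k E m) :
    ofSpan k n (toSpan m f) = 0 := by
  ext t
  refine Finsupp.mapDomain_of_notMem_range _ _ ?_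
  rintro ⟨s, hs⟩
  exact h (by rw [← s.2, hs, t.2])

theorem ofSpan_mem_relationIdeal (n : ℕ) {f : Span k (FamilyGen Ω)}
    (hf : f ∈ totalIdeal la ra q) : ofSpan k n f ∈ relationIdeal la ra q n := by
  refine totalIdeal_induction _ _ (fun m y hy => ?_) hf
  by_cases h : m = n
  · subst h
    rwa [ofSpan_toSpan]
  · rw [ofSpan_toSpan_of_ne h]
    exact Submodule.zero_mem _

theorem normalClass_surjective (n : ℕ) : Function.Surjective (normalClass k la ra q n) := by
  have key : ∀ f ∈ normalSpan k la ra n,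
      (relationIdeal la ra q n).mkQ (ofSpan k n f) ∈ LinearMap.range (normalClass k la ra q n) := by
    intro f hf
    rw [normalSpan, Finsupp.supported_eq_span_single] at hf
    refine (Submodule.span_le (p := (LinearMap.range (normalClass k la ra q n)).comap
      ((relationIdeal la ra q n).mkQ ∘ₗ ofSpan k n))).2 ?_ hf
    rintro _ ⟨t, ht, rfl⟩
    refine ⟨.single ⟨t, ht⟩ 1, ?_⟩
    have : Finsupp.single t (1 : k) = toSpan n (.single ⟨t, ht.2⟩ 1) := by rw [toSpan_single]
    simp [normalClass, this, ofSpan_toSpan]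
  rw [← LinearMap.range_eq_top, eq_top_iff, ← (relationIdeal la ra q n).range_mkQ]
  rintro _ ⟨f, rfl⟩
  induction f using Finsupp.induction_linear with
  | zero => simp
  | add x y hx hy =>
    rw [map_add]
    exact Submodule.add_mem _ hx hy
  | single t c =>
    rw [← mul_one c, ← smul_eq_mul, ← Finsupp.smul_single, map_smul]
    refine Submodule.smul_mem _ _ ?_
    have h := ofSpan_mem_relationIdeal n
      (SModEq.sub_mem.1 (single_smodEq_normalForm (la := la) (ra := ra) (q := q) t.1))
    rw [map_sub, ← toSpan_single t, ofSpan_toSpan] at h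
    have e : (relationIdeal la ra q n).mkQ (.single t 1) =
        (relationIdeal la ra q n).mkQ (ofSpan k n (normalForm la ra q t.1)) :=
      (Submodule.Quotient.eq _).2 h
    rw [e]
    refine key _ ?_
    have := normalForm_mem_normalSpan (k := k) (la := la) (ra := ra) (q := q) t.1
    rwa [t.2] at this

variable (k) in
/-- The normal trees with `n` leaves give a basis of the component of arity `n`. -/
noncomputable def normalEquiv (H : TwistedSemigroup la ra q) (n : ℕ) :
    ({t : PBTree (FamilyGen Ω) // t.Normal la ra ∧ t.leaves = n} →₀ k) ≃ₗ[k]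
      (FreeObj k (FamilyGen Ω) n ⧸ relationIdeal la ra q n) :=
  LinearEquiv.ofBijective _ ⟨normalClass_injective H n, normalClass_surjective n⟩

end Reduction

/-- The generators are two copies of `Ω × Ω`. -/
def FamilyGen.equivSum (Ω : Type*) : (Ω × Ω) ⊕ (Ω × Ω) ≃ FamilyGen Ω where
  toFun := Sum.elim (fun p => prec p.1 p.2) fun p => succ p.1 p.2
  invFun
    | prec α β => .inl (α, β)
    | succ α β => .inr (α, β)
  left_inv := by rintro (_ | _) <;> rfl
  right_inv := by rintro (_ | _) <;> rfl

instance (Ω : Type*) [Fintype Ω] : Fintype (FamilyGen Ω) :=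
  Fintype.ofEquiv _ (FamilyGen.equivSum Ω)

theorem FamilyGen.sum_eq {Ω : Type*} [Fintype Ω] (f : FamilyGen Ω → ℚ) :
    ∑ e, f e = ∑ α, ∑ β, f (prec α β) + ∑ α, ∑ β, f (succ α β) := by
  rw [← (FamilyGen.equivSum Ω).sum_comp, Fintype.sum_sum_type, Fintype.sum_prod_type,
    Fintype.sum_prod_type]
  rfl

namespace PBTree

theorem leaves_pos {E : Type*} (t : PBTree E) : 0 < t.leaves := by
  induction t with
  | leaf => simp [leaves]
  | node e l r ihl ihr => simp only [leaves]; omega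

theorem finite_leaves_le (E : Type*) [Finite E] (n : ℕ) :
    {t : PBTree E | t.leaves ≤ n}.Finite := by
  induction n with
  | zero =>
    convert Set.finite_empty
    ext t
    have := t.leaves_pos
    simp only [Set.mem_ofPred_eq, Set.mem_empty_iff_false, iff_false]
    omega
  | succ n ih =>
    refine ((Set.finite_singleton leaf).union
      (Set.finite_iUnion fun e => Set.Finite.image2 (node e) ih ih)).subset ?_
    rintro (_ | ⟨e, l, r⟩) ht
    · exact .inl rfl
    · have hl := l.leaves_pos
      have hr := r.leaves_pos
      simp only [Set.mem_ofPred_eq, leaves] at ht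
      exact .inr (Set.mem_iUnion.2 ⟨e, Set.mem_image2_of_mem (by simp only [Set.mem_ofPred_eq]; omega)
        (by simp only [Set.mem_ofPred_eq]; omega)⟩)

/-- The trees with `n` leaves. -/
noncomputable def withLeaves (E : Type*) [Finite E] (n : ℕ) : Finset (PBTree E) :=
  ((finite_leaves_le E n).subset fun _ (h : _ = n) => h.le : {t : PBTree E | t.leaves = n}.Finite).toFinset

theorem mem_withLeaves {E : Type*} [Finite E] {n : ℕ} {t : PBTree E} :
    t ∈ withLeaves E n ↔ t.leaves = n := by
  simp [withLeaves]

/-- The generating series of the trees, counted with the weight `φ`. -/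
noncomputable def weightSeries {E : Type*} [Finite E] (φ : PBTree E → ℚ) : PowerSeries ℚ :=
  .mk fun n => ∑ t ∈ withLeaves E n, φ t

theorem weightSeries_add {E : Type*} [Finite E] (φ ψ : PBTree E → ℚ) :
    weightSeries (fun t => φ t + ψ t) = weightSeries φ + weightSeries ψ := by
  ext n
  simp [weightSeries, Finset.sum_add_distrib]

theorem weightSeries_natCast_mul {E : Type*} [Finite E] (c : ℕ) (φ : PBTree E → ℚ) :
    weightSeries (fun t => c * φ t) = c * weightSeries φ := by
  ext n
  rw [← map_natCast (PowerSeries.C (R := ℚ)), PowerSeries.coeff_C_mul]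
  simp [weightSeries, Finset.mul_sum]

theorem weightSeries_of_node {E : Type*} [Fintype E] {φ ρ : PBTree E → ℚ}
    {ψ : E → PBTree E → ℚ} (h : ∀ e l r, φ (node e l r) = ψ e l * ρ r) :
    weightSeries φ = PowerSeries.C (φ leaf) * PowerSeries.X +
      weightSeries (fun l => ∑ e, ψ e l) * weightSeries ρ := by
  classical
  ext n
  rw [map_add, PowerSeries.coeff_C_mul, PowerSeries.coeff_X, PowerSeries.coeff_mul]
  simp only [weightSeries, PowerSeries.coeff_mk]
  rw [← Finset.sum_filter_add_sum_filter_not (withLeaves E n) (· = leaf)]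
  congr 1
  · split_ifs with hn
    · have : (withLeaves E n).filter (· = leaf) = {leaf} := by
        ext t
        simp only [Finset.mem_filter, mem_withLeaves, Finset.mem_singleton, and_iff_right_iff_imp]
        rintro rfl
        exact hn.symm
      rw [this]
      simp
    · have : (withLeaves E n).filter (· = leaf) = ∅ := by
        ext t
        simp only [Finset.mem_filter, mem_withLeaves, Finset.notMem_empty, iff_false, not_and]
        rintro ht rfl
        exact hn ht.symm
      rw [this]
      simp
  · symm
    simp only [Finset.sum_mul, Finset.mul_sum]
    calc _ = ∑ x ∈ (Finset.HasAntidiagonal.antidiagonal n).sigma fun p =>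
          withLeaves E p.2 ×ˢ (withLeaves E p.1 ×ˢ (Finset.univ : Finset E)),
          ψ x.2.2.2 x.2.2.1 * ρ x.2.1 := by
          rw [Finset.sum_sigma]
          simp only [Finset.sum_product]
      _ = _ := by
        refine Finset.sum_nbij (fun x => node x.2.2.2 x.2.2.1 x.2.1) ?_ ?_ ?_ ?_
        · rintro ⟨⟨i, j⟩, r, l, e⟩ hx
          simp only [Finset.mem_sigma, Finset.HasAntidiagonal.mem_antidiagonal, Finset.mem_product,
            mem_withLeaves] at hx
          simp only [Finset.mem_filter, mem_withLeaves, leaves]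
          exact ⟨by omega, nofun⟩
        · rintro ⟨⟨i, j⟩, r, l, e⟩ hx ⟨⟨i', j'⟩, r', l', e'⟩ hx' heq
          simp only [Finset.coe_sigma, Set.mem_sigma_iff, Finset.mem_coe,
            Finset.mem_product, mem_withLeaves] at hx hx'
          obtain ⟨-, rfl, rfl, -⟩ := hx
          obtain ⟨-, rfl, rfl, -⟩ := hx'
          simp only [node.injEq] at heq
          obtain ⟨rfl, rfl, rfl⟩ := heq
          rfl
        · rintro (_ | ⟨e, l, r⟩) ht
          · simp at ht
          · simp only [Finset.coe_filter, Set.mem_ofPred_eq, mem_withLeaves, leaves] at ht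
            refine ⟨⟨(l.leaves, r.leaves), r, l, e⟩, ?_, rfl⟩
            simp [mem_withLeaves, ht.1]
        · rintro ⟨⟨i, j⟩, r, l, e⟩ -
          exact (h e l r).symm

end PBTree

section Counting

variable {Ω : Type*} (la ra : Ω → Ω → Ω)

open Classical in
/-- The indicator function of the normal trees. -/
noncomputable def normalWeight (t : PBTree (FamilyGen Ω)) : ℚ := if t.Normal la ra then 1 else 0

/-- The indicator function of the normal trees with a root `≺`. -/
noncomputable def precWeight : PBTree (FamilyGen Ω) → ℚ
  | leaf => 0
  | node (prec α β) l r => normalWeight la ra (node (prec α β) l r)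
  | node (succ _ _) _ _ => 0

/-- The indicator function of the normal trees with a root `≻`. -/
noncomputable def succWeight : PBTree (FamilyGen Ω) → ℚ
  | leaf => 0
  | node (prec _ _) _ _ => 0
  | node (succ α β) l r => normalWeight la ra (node (succ α β) l r)

open Classical in
/-- The weight of `l` as the left subtree of a vertex `e`. -/
noncomputable def leftWeight (e : FamilyGen Ω) (l : PBTree (FamilyGen Ω)) : ℚ :=
  if IsRedex la ra l e then 0 else normalWeight la ra l

theorem normalWeight_leaf : normalWeight la ra leaf = 1 := if_pos trivial

theorem normalWeight_node (e : FamilyGen Ω) (l r : PBTree (FamilyGen Ω)) :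
    normalWeight la ra (node e l r) = leftWeight la ra e l * normalWeight la ra r := by
  by_cases h₁ : IsRedex la ra l e <;> by_cases h₂ : l.Normal la ra <;>
    by_cases h₃ : r.Normal la ra <;> simp [normalWeight, leftWeight, PBTree.Normal, h₁, h₂, h₃]

/-- The part of `leftWeight` for the vertices `≺`. -/
noncomputable def precLeftWeight : FamilyGen Ω → PBTree (FamilyGen Ω) → ℚ
  | prec α β, l => leftWeight la ra (prec α β) l
  | succ _ _, _ => 0

/-- The part of `leftWeight` for the vertices `≻`. -/
noncomputable def succLeftWeight : FamilyGen Ω → PBTree (FamilyGen Ω) → ℚ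
  | prec _ _, _ => 0
  | succ α β, l => leftWeight la ra (succ α β) l

theorem normalWeight_eq (t : PBTree (FamilyGen Ω)) :
    normalWeight la ra t = (if t.leaves = 1 then 1 else 0) + (precWeight la ra t + succWeight la ra t) := by
  rcases t with _ | ⟨⟨α, β⟩ | ⟨α, β⟩, a, b⟩
  · simp [normalWeight_leaf, leaves, precWeight, succWeight]
  all_goals
    have := a.leaves_pos
    have := b.leaves_pos
    rw [leaves, if_neg (by omega)]
    simp [precWeight, succWeight]

variable [Fintype Ω]

theorem sum_leftWeight_of_isRedex {g : Ω → Ω → FamilyGen Ω} {l : PBTree (FamilyGen Ω)} {c : Ω}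
    (h : ∀ α β, IsRedex la ra l (g α β) ↔ α = c) :
    ∑ α, ∑ β, leftWeight la ra (g α β) l = Fintype.card Ω * (Fintype.card Ω * normalWeight la ra l)
      - Fintype.card Ω * normalWeight la ra l := by
  classical
  have : ∀ α : Ω, ∑ β : Ω, leftWeight la ra (g α β) l = Fintype.card Ω * normalWeight la ra l -
      if α = c then Fintype.card Ω * normalWeight la ra l else 0 := by
    intro α
    by_cases hα : α = c <;> simp [leftWeight, h, hα]
  simp [this, Finset.sum_sub_distrib]

theorem sum_leftWeight_of_not_isRedex {g : Ω → Ω → FamilyGen Ω} {l : PBTree (FamilyGen Ω)}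
    (h : ∀ α β, ¬ IsRedex la ra l (g α β)) :
    ∑ α, ∑ β, leftWeight la ra (g α β) l =
      Fintype.card Ω * (Fintype.card Ω * normalWeight la ra l) := by
  simp [leftWeight, h]

theorem sum_precLeftWeight (l : PBTree (FamilyGen Ω)) :
    ∑ e, precLeftWeight la ra e l + (Fintype.card Ω : ℕ) * (precWeight la ra l + succWeight la ra l)
      = ((Fintype.card Ω ^ 2 : ℕ) : ℚ) * normalWeight la ra l := by
  rw [FamilyGen.sum_eq]
  simp only [precLeftWeight, Finset.sum_const_zero, add_zero, Nat.cast_pow]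
  rcases l with _ | ⟨⟨α, β⟩ | ⟨α, β⟩, a, b⟩
  · rw [sum_leftWeight_of_not_isRedex la ra fun _ _ => id, precWeight, succWeight]
    ring
  · rw [sum_leftWeight_of_isRedex la ra (c := la α β) fun _ _ => Iff.rfl, precWeight, succWeight]
    ring
  · rw [sum_leftWeight_of_isRedex la ra (c := ra α β) fun _ _ => Iff.rfl, precWeight, succWeight]
    ring

theorem sum_succLeftWeight (l : PBTree (FamilyGen Ω)) :
    ∑ e, succLeftWeight la ra e l + (Fintype.card Ω : ℕ) * succWeight la ra l
      = ((Fintype.card Ω ^ 2 : ℕ) : ℚ) * normalWeight la ra l := by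
  rw [FamilyGen.sum_eq]
  simp only [succLeftWeight, Finset.sum_const_zero, zero_add, Nat.cast_pow]
  rcases l with _ | ⟨⟨α, β⟩ | ⟨α, β⟩, a, b⟩
  · rw [sum_leftWeight_of_not_isRedex la ra fun _ _ => id, succWeight]
    ring
  · rw [sum_leftWeight_of_not_isRedex la ra fun _ _ => id, succWeight]
    ring
  · rw [sum_leftWeight_of_isRedex la ra (c := ra α β) fun _ _ => Iff.rfl, succWeight]
    ring

theorem weightSeries_normalWeight : weightSeries (normalWeight la ra) =
    PowerSeries.X + (weightSeries (precWeight la ra) + weightSeries (succWeight la ra)) := by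
  rw [funext (normalWeight_eq la ra), weightSeries_add, weightSeries_add]
  congr 1
  rw [weightSeries_of_node (ρ := 0) (ψ := 0)]
  · have : weightSeries (0 : PBTree (FamilyGen Ω) → ℚ) = 0 := by
      ext n
      simp [weightSeries]
    simp [leaves, this]
  · intro e l r
    have := l.leaves_pos
    have := r.leaves_pos
    rw [leaves, if_neg (by omega)]
    simp

theorem weightSeries_precWeight : weightSeries (precWeight la ra) +
    (Fintype.card Ω : ℕ) * (weightSeries (precWeight la ra) + weightSeries (succWeight la ra)) *
      weightSeries (normalWeight la ra) =
    ((Fintype.card Ω ^ 2 : ℕ) : PowerSeries ℚ) * weightSeries (normalWeight la ra) ^ 2 := by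
  have h : weightSeries (precWeight la ra) =
      weightSeries (fun l => ∑ e, precLeftWeight la ra e l) * weightSeries (normalWeight la ra) := by
    rw [weightSeries_of_node (φ := precWeight la ra) (ψ := precLeftWeight la ra)
      (ρ := normalWeight la ra)]
    · simp [precWeight]
    · rintro (_ | _) l r
      · exact normalWeight_node la ra _ _ _
      · simp [precWeight, precLeftWeight]
  have h' := congrArg weightSeries (funext (sum_precLeftWeight la ra))
  rw [weightSeries_add, weightSeries_natCast_mul, weightSeries_natCast_mul, weightSeries_add] at h'
  linear_combination h + weightSeries (normalWeight la ra) * h'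

theorem weightSeries_succWeight : weightSeries (succWeight la ra) +
    (Fintype.card Ω : ℕ) * weightSeries (succWeight la ra) * weightSeries (normalWeight la ra) =
    ((Fintype.card Ω ^ 2 : ℕ) : PowerSeries ℚ) * weightSeries (normalWeight la ra) ^ 2 := by
  have h : weightSeries (succWeight la ra) =
      weightSeries (fun l => ∑ e, succLeftWeight la ra e l) * weightSeries (normalWeight la ra) := by
    rw [weightSeries_of_node (φ := succWeight la ra) (ψ := succLeftWeight la ra)
      (ρ := normalWeight la ra)]
    · simp [succWeight]
    · rintro (_ | _) l r
      · simp [succWeight, succLeftWeight]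
      · exact normalWeight_node la ra _ _ _
  have h' := congrArg weightSeries (funext (sum_succLeftWeight la ra))
  rw [weightSeries_add, weightSeries_natCast_mul, weightSeries_natCast_mul] at h'
  linear_combination h + weightSeries (normalWeight la ra) * h'

theorem normalSeries_equation {w R : PowerSeries ℚ} (hw : w = (Fintype.card Ω : ℕ))
    (hR : R = weightSeries (normalWeight la ra)) :
    w ^ 2 * (w - 1) * R ^ 3 + w * (w * PowerSeries.X + 2 * w - 2) * R ^ 2 +
      (2 * w * PowerSeries.X - 1) * R + PowerSeries.X = 0 := by
  have h₁ := weightSeries_normalWeight la ra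
  have h₂ := weightSeries_precWeight la ra
  have h₃ := weightSeries_succWeight la ra
  rw [Nat.cast_pow, ← hw, ← hR] at h₂ h₃
  rw [← hR] at h₁
  generalize weightSeries (precWeight la ra) = P at *
  generalize weightSeries (succWeight la ra) = S at *
  obtain rfl : S = R - PowerSeries.X - P := by linear_combination -h₁
  obtain rfl : P = w ^ 2 * R ^ 2 - w * (R - PowerSeries.X) * R := by linear_combination h₂
  linear_combination -h₃

theorem coeff_weightSeries_normalWeight (n : ℕ) :
    PowerSeries.coeff n (weightSeries (normalWeight la ra)) =
      Nat.card {t : PBTree (FamilyGen Ω) // t.Normal la ra ∧ t.leaves = n} := by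
  classical
  have e : ∀ t : PBTree (FamilyGen Ω), t.Normal la ra ∧ t.leaves = n ↔
      t ∈ (withLeaves (FamilyGen Ω) n).filter fun t => t.Normal la ra := by
    simp [mem_withLeaves, and_comm]
  rw [Nat.card_congr (Equiv.subtypeEquivRight e), Nat.card_eq_fintype_card, Fintype.card_coe]
  simp [weightSeries, normalWeight]

end Counting

theorem finite_normal {Ω : Type*} [Finite Ω] (la ra : Ω → Ω → Ω) (n : ℕ) :
    Finite {t : PBTree (FamilyGen Ω) // t.Normal la ra ∧ t.leaves = n} := by
  have := Fintype.ofFinite Ω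
  exact ((finite_leaves_le (FamilyGen Ω) n).subset fun t ht => ht.2.le :
    {t : PBTree (FamilyGen Ω) | t.Normal la ra ∧ t.leaves = n}.Finite)

section Main

variable {k : Type*} [Field k] {Ω : Type*} [Finite Ω]

theorem finite_quotient {la ra : Ω → Ω → Ω} {q : k} (H : TwistedSemigroup la ra q) (n : ℕ) :
    Module.Finite k (FreeObj k (FamilyGen Ω) n ⧸ relationIdeal la ra q n) := by
  have := finite_normal la ra n
  exact Module.Finite.equiv (normalEquiv k H n)

theorem finrank_quotient {la ra : Ω → Ω → Ω} {q : k} (H : TwistedSemigroup la ra q) (n : ℕ) :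
    Module.finrank k (FreeObj k (FamilyGen Ω) n ⧸ relationIdeal la ra q n) =
      Nat.card {t : PBTree (FamilyGen Ω) // t.Normal la ra ∧ t.leaves = n} := by
  have := finite_normal la ra n
  have := Fintype.ofFinite {t : PBTree (FamilyGen Ω) // t.Normal la ra ∧ t.leaves = n}
  rw [← (normalEquiv k H n).finrank_eq, Module.finrank_finsupp_self, Nat.card_eq_fintype_card]

theorem normalSeries_unique {w R R' : PowerSeries ℚ}
    (h₀ : PowerSeries.constantCoeff R = 0) (h₀' : PowerSeries.constantCoeff R' = 0)
    (h : w ^ 2 * (w - 1) * R ^ 3 + w * (w * PowerSeries.X + 2 * w - 2) * R ^ 2 +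
      (2 * w * PowerSeries.X - 1) * R + PowerSeries.X = 0)
    (h' : w ^ 2 * (w - 1) * R' ^ 3 + w * (w * PowerSeries.X + 2 * w - 2) * R' ^ 2 +
      (2 * w * PowerSeries.X - 1) * R' + PowerSeries.X = 0) : R = R' := by
  have key : (R - R') * (w ^ 2 * (w - 1) * (R ^ 2 + R * R' + R' ^ 2) +
      w * (w * PowerSeries.X + 2 * w - 2) * (R + R') + 2 * w * PowerSeries.X - 1) = 0 := by
    linear_combination h - h'
  rcases mul_eq_zero.1 key with h | h
  · exact sub_eq_zero.1 h
  · have := congrArg PowerSeries.constantCoeff h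
    simp [h₀, h₀'] at this

theorem constantCoeff_weightSeries {E : Type*} [Finite E] (φ : PBTree E → ℚ) :
    PowerSeries.constantCoeff (weightSeries φ) = 0 := by
  rw [← PowerSeries.coeff_zero_eq_constantCoeff_apply, weightSeries, PowerSeries.coeff_mk]
  refine Finset.sum_eq_zero fun t ht => ?_
  have := t.leaves_pos
  rw [mem_withLeaves] at ht
  omega

/-- The number of normal trees depends only on the cardinality of `Ω`. -/
theorem card_normal_eq (la ra la' ra' : Ω → Ω → Ω) (n : ℕ) :
    Nat.card {t : PBTree (FamilyGen Ω) // t.Normal la ra ∧ t.leaves = n} =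
      Nat.card {t : PBTree (FamilyGen Ω) // t.Normal la' ra' ∧ t.leaves = n} := by
  have := Fintype.ofFinite Ω
  have h := normalSeries_unique (constantCoeff_weightSeries _) (constantCoeff_weightSeries _)
    (normalSeries_equation la ra rfl rfl) (normalSeries_equation la' ra' rfl rfl)
  have := congrArg (PowerSeries.coeff n) h
  rwa [coeff_weightSeries_normalWeight, coeff_weightSeries_normalWeight, Nat.cast_inj] at this

theorem dendOperad_obj (S : DiassociativeSemigroup Ω) (n : ℕ) :
    Module.Finite k ((dendOperad k S).obj n) ∧ Module.finrank k ((dendOperad k S).obj n) =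
      Nat.card {t : PBTree (FamilyGen Ω) // t.Normal S.la S.ra ∧ t.leaves = n} := by
  unfold dendOperad
  rw [dendRelations_eq]
  exact ⟨finite_quotient (S.twisted k) n, finrank_quotient (S.twisted k) n⟩

theorem dupOperad_obj (T : DuplicialSemigroup Ω) (n : ℕ) :
    Module.Finite k ((dupOperad k T).obj n) ∧ Module.finrank k ((dupOperad k T).obj n) =
      Nat.card {t : PBTree (FamilyGen Ω) // t.Normal T.la T.ra ∧ t.leaves = n} := by
  unfold dupOperad
  rw [dupRelations_eq]
  exact ⟨finite_quotient (T.twisted k) n, finrank_quotient (T.twisted k) n⟩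

theorem genSeries_dendOperad [Fintype Ω] (S : DiassociativeSemigroup Ω) :
    (dendOperad k S).genSeries = weightSeries (normalWeight S.la S.ra) := by
  ext n
  rw [NSOperad.genSeries, PowerSeries.coeff_mk]
  split_ifs with hn
  · rw [hn, PowerSeries.coeff_zero_eq_constantCoeff_apply, constantCoeff_weightSeries]
  · rw [coeff_weightSeries_normalWeight, (dendOperad_obj S n).2]

end Main

theorem mainTheorem6 (k : Type*) [Field k] (Ω : Type*) [Finite Ω]
    (S : DiassociativeSemigroup Ω) (T : DuplicialSemigroup Ω) :
    (∀ n : ℕ, 1 ≤ n →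
      Module.Finite k ((dendOperad k S).obj n) ∧
      Module.Finite k ((dupOperad k T).obj n) ∧
      Module.finrank k ((dendOperad k S).obj n) = Module.finrank k ((dupOperad k T).obj n)) ∧
    (let w : PowerSeries ℚ := (Nat.card Ω : PowerSeries ℚ)
     let X : PowerSeries ℚ := PowerSeries.X
     let R : PowerSeries ℚ := (dendOperad k S).genSeries
     w ^ 2 * (w - 1) * R ^ 3 + w * (w * X + 2 * w - 2) * R ^ 2 + (2 * w * X - 1) * R + X = 0) := by
  refine ⟨fun n _ => ⟨(dendOperad_obj S n).1, (dupOperad_obj T n).1, ?_⟩, ?_⟩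
  · rw [(dendOperad_obj S n).2, (dupOperad_obj T n).2]
    exact card_normal_eq _ _ _ _ n
  · have := Fintype.ofFinite Ω
    refine normalSeries_equation S.la S.ra ?_ (genSeries_dendOperad S)
    rw [Nat.card_eq_fintype_card]
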